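/- Let $H$ and $V$ be (real or complex) Hilbert spaces with $V\hookrightarrow H$ continuously and densely. Let $\Lambda$ be the positive self-adjoint operator in $H$ with domain $D(\Lambda)=V$ and $(\Lambda u,\Lambda v)_H=(u,v)_V$ for all $u,v\in V$, and for $0<\theta<1$ let $[H,V]_\theta:=D(\Lambda^\theta)$ with the graph norm $\|x\|_{[H,V]_\theta}=(\|x\|_H^2+\|\Lambda^\theta x\|_H^2)^{1/2}$. For an integer $m\ge 1$ and $0<\tau\le\infty$ let $$Z^m(0,\tau)=\Big\{f\in L^2(0,\tau;V):\ \tfrac{d^mf}{dt^m}\in L^2(0,\tau;H)\Big\},\qquad \|f\|_{Z^m(0,\tau)}=\Big(\|f\|^2_{L^2(0,\tau;V)}+\big\|\tfrac{d^mf}{dt^m}\big\|^2_{L^2(0,\tau;H)}\Big)^{1/2},$$ with derivatives in the sense of distributions. (Every $f\in Z^m(0,\tau)$ has distributional derivatives $\frac{d^jf}{dt^j}$, $0\le j\le m-1$, that are represented by continuous functions $[0,\tau]\to H$, so that the values $\frac{d^jf(0)}{dt^j}\in H$ are defined; for $\tau=\infty$, $[0,\tau]$ is read as $[0,\infty)$.)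 There is a constant $k_5>0$, depending only on $H$, $V$ (with the embedding) and $m$, and in particular independent of $\tau$ and $f$, such that the following holds for all $0<\tau\le\infty$. If $f\in Z^m(0,\tau)$ satisfies $$\frac{d^jf(0)}{dt^j}\in[H,V]_{1-\frac{2j+1}{2m}}\qquad\text{for each } j=0,1,\dots,m-1,$$ then $$\frac{d^jf}{dt^j}\in C\big([0,\tau];[H,V]_{1-\frac{2j+1}{2m}}\big)\qquad\text{for each } j=0,1,\dots,m-1,$$ and, for each such $j$, $$\sup_{t\in[0,\tau]}\Big\|\frac{d^jf(t)}{dt^j}\Big\|_{[H,V]_{1-\frac{2j+1}{2m}}}\le k_5\Big(\|f\|_{Z^m(0,\tau)}+\sum_{i=0}^{m-1}\Big\|\frac{d^if(0)}{dt^i}\Big\|_{[H,V]_{1-\frac{2i+1}{2m}}}\Big).$$ -/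

import Mathlib

open MeasureTheory Set
open scoped ContDiff

noncomputable section

namespace LionsMagenes

variable {𝕜 H V : Type*} [RCLike 𝕜]
  [NormedAddCommGroup H] [InnerProductSpace 𝕜 H] [NormedSpace ℝ H] [CompleteSpace H]
  [NormedAddCommGroup V] [InnerProductSpace 𝕜 V] [CompleteSpace V]

/-! ### Fractional powers and the interpolation spaces `[H, V]_θ` -/

/-- The fractional power `T ^ s`, `0 < s < 1`, of a bounded positive self-adjoint operator `T`:
`T ^ s = (sin (π s) / π) ∫₀^∞ r ^ (s - 1) T (r + T)⁻¹ dr` (Balakrishnan's formula, the integral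
converges in operator norm). It makes sense over real and over complex scalars. -/
def fracPow (T : H →L[𝕜] H) (s : ℝ) : H →L[𝕜] H :=
  (Real.sin (Real.pi * s) / Real.pi) •
    ∫ r in Ioi (0 : ℝ), r ^ (s - 1) • (T * Ring.inverse ((r : 𝕜) • (1 : H →L[𝕜] H) + T))

/-- Let `ι : V → H` be a continuous dense embedding of Hilbert spaces. The positive self-adjoint
operator `S` in `H` associated with the inner product of `V`, that is
`(S u, v)_H = (u, v)_V` for all `v ∈ V`, has the bounded inverse `S⁻¹ = ι ι*`. -/
def formInv (ι : V →L[𝕜] H) : H →L[𝕜] H := ι ∘L ContinuousLinearMap.adjoint ι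

/-- The interpolation space `[H, V]_θ`, `0 < θ < 1`, is the domain `D(Λ ^ θ)` with its graph norm,
where `Λ = S ^ (1/2)` is the positive self-adjoint operator in `H` with `D(Λ) = V` and
`(Λ u, Λ v)_H = (u, v)_V`. It is realised as the graph of `Λ ^ θ`, i.e. as the set of the pairs
`(x, y)` with `x = Λ ^ (-θ) y = (S⁻¹) ^ (θ / 2) y`, in the Hilbert space `H × H`;
so the norm of `(x, Λ ^ θ x)` is `(‖x‖² + ‖Λ ^ θ x‖²) ^ (1/2)`. -/
def interpSpace (ι : V →L[𝕜] H) (θ : ℝ) : Submodule 𝕜 (WithLp 2 (H × H)) where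
  carrier := {p | p.fst = fracPow (formInv ι) (θ / 2) p.snd}
  add_mem' := by
    intro p q hp hq
    simp only [mem_ofPred_eq] at hp hq ⊢
    simp [hp, hq]
  zero_mem' := by simp
  smul_mem' := by
    intro c p hp
    simp only [mem_ofPred_eq] at hp ⊢
    simp [hp]

/-- The embedding of `[H, V]_θ` in `H`. -/
def interpToH {ι : V →L[𝕜] H} {θ : ℝ} (p : interpSpace ι θ) : H := p.1.fst

/-! ### Weak derivatives and the spaces `Z ^ m (0, τ)` -/

/-- The open interval `(0, τ)`, where `τ ∈ (0, ∞]`. -/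
def openI (τ : EReal) : Set ℝ := {t | 0 < t ∧ (t : EReal) < τ}

/-- The interval `[0, τ]`, where `τ ∈ (0, ∞]`; it is `[0, ∞)` for `τ = ∞`. -/
def closedI (τ : EReal) : Set ℝ := {t | 0 ≤ t ∧ (t : EReal) ≤ τ}

/-- `w` is the `n`-th derivative of `u` in the sense of `H`-valued distributions on the open
interval `I`. -/
def IsWeakDeriv (I : Set ℝ) (n : ℕ) (u w : ℝ → H) : Prop :=
  LocallyIntegrableOn u I ∧ LocallyIntegrableOn w I ∧
    ∀ φ : ℝ → ℝ, ContDiff ℝ ∞ φ → HasCompactSupport φ → tsupport φ ⊆ I →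
      ∫ t in I, iteratedDeriv n φ t • u t = (-1 : ℝ) ^ n • ∫ t in I, φ t • w t

/-- `f ∈ Z ^ m (0, τ)` with `m`-th derivative `F`: `f ∈ L²(0, τ; V)`, `F ∈ L²(0, τ; H)`, and
`F = dᵐf/dtᵐ` in the sense of distributions. -/
def MemZ (ι : V →L[𝕜] H) (m : ℕ) (τ : EReal) (f : ℝ → V) (F : ℝ → H) : Prop :=
  MemLp f 2 (volume.restrict (openI τ)) ∧ MemLp F 2 (volume.restrict (openI τ)) ∧
    IsWeakDeriv (openI τ) m (fun t => ι (f t)) F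

/-- The norm of `Z ^ m (0, τ)` for a function `f` with `m`-th derivative `F`. -/
def normZ (τ : EReal) (f : ℝ → V) (F : ℝ → H) : ℝ :=
  √((∫ t in openI τ, ‖f t‖ ^ 2) + ∫ t in openI τ, ‖F t‖ ^ 2)

/-- The exponent `1 - (2 j + 1) / (2 m)`. -/
def traceExp (m j : ℕ) : ℝ := 1 - (2 * j + 1) / (2 * m)

/-- `g` is the continuous representative `[0, τ] → H` of the `j`-th distributional derivative
of `f : (0, τ) → V`; for given `f` and `j` it is unique on `[0, τ]`. -/
def IsContDeriv (ι : V →L[𝕜] H) (τ : EReal) (f : ℝ → V) (j : ℕ) (g : ℝ → H) : Prop :=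
  ContinuousOn g (closedI τ) ∧ IsWeakDeriv (openI τ) j (fun t => ι (f t)) g

end LionsMagenes

end

/-! Let `T = ι ι* = Λ⁻²` and let `B = T^{1/(4m)} = Λ^{-1/(2m)}`. Then `f = B^{2m} v` with `‖v‖ ≤
‖f‖_V`, and the `j`-th trace space is the range of `B^{2m-2j-1}`. The claim becomes `D j =
B^{2m-2j-1} w` with `w` continuous and bounded by the data.

Formally put `h_j = Λ D_j`. Let `e_j` be the norm of `B^{2j} h_j` in `L²(0,b;H)`, and let `s_j`,
`p_j` be the norms of `B^{2j+1} h_j` at `b` and at `0`. Then `e_0` and `e_m` are controlled by the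
`Z^m` norm, the `p_j` by the initial data, and the `s_j` are wanted. Differentiating `‖B^{2j+1}
h_j‖²` gives `s_j² ≤ p_j² + 2 e_j e_{j+1}`. Integrating `e_{i+1}²` by parts gives `e_{i+1}² ≤ e_i
e_{i+2} + s_i s_{i+1} + p_i p_{i+1}`. These inequalities alone bound every `s_j`
(`le_of_energy_inequalities`). The length of the interval never enters, so the constant does not
depend on `τ`; the assumed initial values take the place of a trace theorem, whose constant would
blow up on short intervals.

Since `Λ D_j` need not exist, `Λ` is replaced by `B^{2m} Q` with `Q = (r + T)⁻¹`, so that `B^{4m} Q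
→ 1` strongly as `r → 0`. The estimate is linear in `Q`: applied to differences it yields uniform
convergence to a continuous `w`, and applied to `Q` itself it yields the bound
(`exists_continuous_preimage`).

The powers of `T` come from a functional calculus valid over real and complex scalars, and the
derivatives `D j` from repeated primitives of `F`. -/

noncomputable section

namespace LionsMagenes

/-! ### Norm bounds for real polynomials of a positive operator. -/

section Compression

variable {𝕜 : Type*} [RCLike 𝕜]

open Polynomial in
theorem eigenvectorBasis_repr_aeval {E : Type*} [NormedAddCommGroup E] [InnerProductSpace 𝕜 E]
    [FiniteDimensional 𝕜 E] {S : E →ₗ[𝕜] E} (hS : S.IsSymmetric) {n : ℕ}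
    (hn : Module.finrank 𝕜 E = n) (p : ℝ[X]) (x : E) (i : Fin n) :
    (hS.eigenvectorBasis hn).repr (aeval S (p.map (algebraMap ℝ 𝕜)) x) i =
      ((p.eval (hS.eigenvalues hn i) : ℝ) : 𝕜) * (hS.eigenvectorBasis hn).repr x i := by
  have hpow : ∀ k : ℕ, (hS.eigenvectorBasis hn).repr ((S ^ k) x) i =
      ((hS.eigenvalues hn i ^ k : ℝ) : 𝕜) * (hS.eigenvectorBasis hn).repr x i := by
    intro k
    induction k with
    | zero => simp
    | succ k ih =>
      rw [pow_succ', Module.End.mul_apply, hS.eigenvectorBasis_apply_self_apply, ih]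
      push_cast
      ring
  induction p using Polynomial.induction_on' with
  | add p q hp hq =>
    simp only [Polynomial.map_add, map_add, LinearMap.add_apply, PiLp.add_apply, hp, hq,
      Polynomial.eval_add]
    ring
  | monomial k a =>
    rw [Polynomial.map_monomial, Polynomial.aeval_monomial, ← Algebra.smul_def,
      LinearMap.smul_apply, map_smul, PiLp.smul_apply, hpow, Polynomial.eval_monomial]
    simp [mul_assoc]

open Polynomial in
theorem norm_aeval_apply_le_of_eigenvalues {E : Type*} [NormedAddCommGroup E]
    [InnerProductSpace 𝕜 E] [FiniteDimensional 𝕜 E] {S : E →ₗ[𝕜] E} (hS : S.IsSymmetric) {n : ℕ}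
    (hn : Module.finrank 𝕜 E = n) (p : ℝ[X]) {C : ℝ} (hC0 : 0 ≤ C)
    (hC : ∀ i, |p.eval (hS.eigenvalues hn i)| ≤ C) (x : E) :
    ‖aeval S (p.map (algebraMap ℝ 𝕜)) x‖ ≤ C * ‖x‖ := by
  set b := hS.eigenvectorBasis hn
  refine le_of_sq_le_sq ?_ (by positivity)
  rw [← b.repr.norm_map, ← b.repr.norm_map x, mul_pow, EuclideanSpace.norm_sq_eq,
    EuclideanSpace.norm_sq_eq, Finset.mul_sum]
  refine Finset.sum_le_sum fun i _ => ?_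
  rw [eigenvectorBasis_repr_aeval hS hn p x i, norm_mul, mul_pow, RCLike.norm_ofReal]
  have := hC i
  gcongr

/-- A real polynomial `p` of a positive operator `T` is bounded by the maximum of `|p|` on
`[0, ‖T‖]`: compress `T` to the span of the vectors `T ^ k x`, `k ≤ deg p`. -/
theorem norm_aeval_apply_le {H : Type*} [NormedAddCommGroup H] [InnerProductSpace 𝕜 H]
    {T : H →L[𝕜] H} (hT : T.IsPositive) (p : Polynomial ℝ) {C : ℝ}
    (hC : ∀ r ∈ Icc 0 ‖T‖, |p.eval r| ≤ C) (x : H) :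
    ‖Polynomial.aeval T (p.map (algebraMap ℝ 𝕜)) x‖ ≤ C * ‖x‖ := by
  have hC0 : 0 ≤ C := (abs_nonneg _).trans (hC 0 ⟨le_rfl, norm_nonneg _⟩)
  set W : Submodule 𝕜 H :=
    Submodule.span 𝕜 (Set.range fun k : Fin (p.natDegree + 1) => (T ^ (k : ℕ)) x) with hW
  have hWfin : FiniteDimensional 𝕜 W := FiniteDimensional.span_of_finite 𝕜 (Set.finite_range _)
  have hmem : ∀ k ≤ p.natDegree, (T ^ k) x ∈ W := fun k hk =>
    Submodule.subset_span ⟨⟨k, by omega⟩, rfl⟩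
  set S : W →ₗ[𝕜] W :=
    W.orthogonalProjectionOnto.toLinearMap ∘ₗ T.toLinearMap ∘ₗ W.subtype with hSdef
  have hSapp : ∀ w : W, S w = W.orthogonalProjectionOnto (T w) := fun w => rfl
  have hSin : ∀ w v : W, inner 𝕜 (S w) v = inner 𝕜 (T w) (v : H) := by
    intro w v
    rw [hSapp, Submodule.inner_orthogonalProjectionOnto_eq_of_mem_right]
  have hSsym : S.IsSymmetric := by
    intro w v
    rw [hSin, ← inner_conj_symm w, hSin, inner_conj_symm]
    exact hT.isSymmetric w v
  set x' : W := ⟨x, by simpa using hmem 0 (Nat.zero_le _)⟩ with hx'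
  -- The projection in `S` does nothing as long as the next power `T ^ (k + 1) x` still lies in `W`.
  -- This covers exactly the powers that occur in `p`.
  have hpow : ∀ k ≤ p.natDegree, ((S ^ k) x' : H) = (T ^ k) x := by
    intro k
    induction k with
    | zero => intro _; simp [hx']
    | succ k ih =>
      intro hk
      have h1 := ih (by omega)
      rw [pow_succ', Module.End.mul_apply, hSapp, h1, pow_succ', mul_apply_eq_comp]
      have h2 : T ((T ^ k) x) ∈ W := by
        simpa [pow_succ'] using hmem (k + 1) hk
      exact W.starProjection_eq_self_iff.2 h2
  have hae : Polynomial.aeval T (p.map (algebraMap ℝ 𝕜)) x =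
      Polynomial.aeval S (p.map (algebraMap ℝ 𝕜)) x' := by
    rw [Polynomial.aeval_eq_sum_range, Polynomial.aeval_eq_sum_range]
    simp only [sum_apply, LinearMap.sum_apply, Submodule.coe_sum,
      smul_apply, LinearMap.smul_apply, Submodule.coe_smul]
    refine Finset.sum_congr rfl fun k hk => ?_
    rw [hpow k]
    have := Finset.mem_range.1 hk
    have := Polynomial.natDegree_map_le (f := algebraMap ℝ 𝕜) (p := p)
    omega
  rw [hae]
  refine norm_aeval_apply_le_of_eigenvalues hSsym rfl p hC0 (fun i => hC _ ?_) x'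
  set v := hSsym.eigenvectorBasis rfl i with hv
  have hvn : ‖v‖ = 1 := (hSsym.eigenvectorBasis rfl).orthonormal.1 i
  -- An eigenvalue of the compression is a Rayleigh quotient of `T`, hence lies in `[0, ‖T‖]`.
  have hev : hSsym.eigenvalues rfl i = RCLike.re (inner 𝕜 (T v) (v : H)) := by
    rw [← hSin, hv, hSsym.apply_eigenvectorBasis, inner_smul_left, inner_self_eq_norm_sq_to_K,
      ← hv, hvn]
    simp
  rw [hev]
  refine ⟨hT.re_inner_nonneg_left _,
    (RCLike.re_le_norm _).trans ((norm_inner_le_norm _ _).trans ?_)⟩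
  have hvn' : ‖(v : H)‖ = 1 := hvn
  simpa [hvn'] using T.le_opNorm (v : H)

end Compression

/-! ### Continuous functional calculus on `[0, ‖T‖]`. -/

section FunctionalCalculus

variable {𝕜 H V : Type*} [RCLike 𝕜]
  [NormedAddCommGroup H] [InnerProductSpace 𝕜 H] [NormedSpace ℝ H] [CompleteSpace H]
  [NormedAddCommGroup V] [InnerProductSpace 𝕜 V] [CompleteSpace V]

omit [CompleteSpace H] in
theorem ofReal_smul_eq (r : ℝ) (x : H) : (r : 𝕜) • x = r • x := by
  rw [RCLike.ofReal_alg, smul_assoc, one_smul]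

omit [CompleteSpace H] in
theorem ofReal_smul_clm_eq (r : ℝ) (A : H →L[𝕜] H) : (r : 𝕜) • A = r • A :=
  ContinuousLinearMap.ext fun x => ofReal_smul_eq r (A x)

omit [NormedSpace ℝ H] [CompleteSpace H] in
theorem isSymmetric_clm_pow {B : H →L[𝕜] H} (hB : B.IsSymmetric) (n : ℕ) :
    (B ^ n).IsSymmetric := by
  rw [ContinuousLinearMap.toLinearMap_pow]
  exact LinearMap.IsSymmetric.pow hB n

/-- Substitution of an operator in a real polynomial. -/
def polyCalc (T : H →L[𝕜] H) : Polynomial ℝ →ₗ[ℝ] (H →L[𝕜] H) where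
  toFun p := Polynomial.aeval T (p.map (algebraMap ℝ 𝕜))
  map_add' p q := by simp
  map_smul' r p := by
    rw [Polynomial.map_smul, map_smul, RingHom.id_apply, ← ofReal_smul_clm_eq (𝕜 := 𝕜)]

/-- Restriction of real polynomials to `[0, ‖T‖]`. -/
def polyRestrict (T : H →L[𝕜] H) : Polynomial ℝ →ₗ[ℝ] C(Icc 0 ‖T‖, ℝ) :=
  (Polynomial.toContinuousMapOnAlgHom (Icc 0 ‖T‖)).toLinearMap

/-- The continuous functional calculus of a positive operator over real or complex scalars. -/
def contCalc (T : H →L[𝕜] H) : C(Icc 0 ‖T‖, ℝ) →L[ℝ] (H →L[𝕜] H) :=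
  (polyCalc T).extendOfNorm (polyRestrict T)

omit [NormedSpace ℝ H] [CompleteSpace H] in
theorem denseRange_polyRestrict (T : H →L[𝕜] H) : DenseRange (polyRestrict T) := by
  intro f
  have := continuousMap_mem_polynomialFunctions_closure 0 ‖T‖ f
  rwa [← SetLike.mem_coe, Subalgebra.topologicalClosure_coe, polynomialFunctions_coe] at this

variable {T : H →L[𝕜] H} (hT : T.IsPositive)
include hT

-- This bound and the Weierstrass density give `extendOfNorm` its meaning in `contCalc`; the factor
-- `1` is the constant expected there.
omit [CompleteSpace H] in
theorem norm_polyCalc_le (p : Polynomial ℝ) : ‖polyCalc T p‖ ≤ 1 * ‖polyRestrict T p‖ := by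
  rw [one_mul]
  refine ContinuousLinearMap.opNorm_le_bound _ (norm_nonneg _) fun x => ?_
  refine norm_aeval_apply_le hT p (fun r hr => ?_) x
  exact (polyRestrict T p).norm_coe_le_norm ⟨r, hr⟩

theorem contCalc_polyRestrict (p : Polynomial ℝ) : contCalc T (polyRestrict T p) = polyCalc T p :=
  LinearMap.extendOfNorm_eq (denseRange_polyRestrict T) ⟨1, norm_polyCalc_le hT⟩ p

theorem norm_contCalc_le (f : C(Icc 0 ‖T‖, ℝ)) : ‖contCalc T f‖ ≤ ‖f‖ :=
  (LinearMap.norm_extendOfNorm_apply_le (denseRange_polyRestrict T) 1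
    (norm_polyCalc_le hT) f).trans_eq (one_mul _)

theorem contCalc_mul (f g : C(Icc 0 ‖T‖, ℝ)) :
    contCalc T (f * g) = contCalc T f * contCalc T g := by
  refine (denseRange_polyRestrict T).induction_on₂
    (p := fun f g => contCalc T (f * g) = contCalc T f * contCalc T g) ?_ (fun p q => ?_) f g
  · exact isClosed_eq (by fun_prop) (by fun_prop)
  · have : polyRestrict T p * polyRestrict T q = polyRestrict T (p * q) :=
      (map_mul (Polynomial.toContinuousMapOnAlgHom (Icc 0 ‖T‖)) p q).symm
    rw [this, contCalc_polyRestrict hT, contCalc_polyRestrict hT, contCalc_polyRestrict hT]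
    simp [polyCalc]

theorem contCalc_one : contCalc T 1 = 1 := by
  have : polyRestrict T 1 = 1 := map_one (Polynomial.toContinuousMapOnAlgHom (Icc 0 ‖T‖))
  rw [← this, contCalc_polyRestrict hT]
  simp [polyCalc]

theorem contCalc_id : contCalc T ((ContinuousMap.id ℝ).restrict (Icc 0 ‖T‖)) = T := by
  have : polyRestrict T Polynomial.X = (ContinuousMap.id ℝ).restrict (Icc 0 ‖T‖) :=
    Polynomial.toContinuousMapOn_X_eq_restrict_id _
  rw [← this, contCalc_polyRestrict hT]
  simp [polyCalc]

theorem contCalc_pow (f : C(Icc 0 ‖T‖, ℝ)) (n : ℕ) : contCalc T (f ^ n) = contCalc T f ^ n := by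
  induction n with
  | zero => simp [contCalc_one hT]
  | succ n ih => rw [pow_succ, pow_succ, contCalc_mul hT, ih]

theorem contCalc_isSymmetric (f : C(Icc 0 ‖T‖, ℝ)) : (contCalc T f).IsSymmetric := by
  intro x y
  refine (denseRange_polyRestrict T).induction_on
    (p := fun f => inner 𝕜 (contCalc T f x) y = inner 𝕜 x (contCalc T f y)) f
    (isClosed_eq (by fun_prop) (by fun_prop)) fun p => ?_
  rw [contCalc_polyRestrict hT]
  induction p using Polynomial.induction_on' with
  | add p q hp hq => simp only [map_add, add_apply, inner_add_left, inner_add_right, hp, hq]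
  | monomial k a =>
    have hk : inner 𝕜 ((T ^ k) x) y = inner 𝕜 x ((T ^ k) y) :=
      isSymmetric_clm_pow hT.isSymmetric k x y
    have ha : polyCalc T (Polynomial.monomial k a) = (a : 𝕜) • T ^ k := by
      simp [polyCalc, Polynomial.map_monomial, Polynomial.aeval_monomial, ← Algebra.smul_def]
    rw [ha, smul_apply, smul_apply, inner_smul_left, inner_smul_right, hk, RCLike.conj_ofReal]

theorem contCalc_commute (f g : C(Icc 0 ‖T‖, ℝ)) : Commute (contCalc T f) (contCalc T g) := by
  rw [Commute, SemiconjBy, ← contCalc_mul hT, ← contCalc_mul hT, mul_comm]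

end FunctionalCalculus

/-! ### Roots, resolvents and the Balakrishnan formula. -/

section FractionalPowers

variable {𝕜 H V : Type*} [RCLike 𝕜]
  [NormedAddCommGroup H] [InnerProductSpace 𝕜 H] [NormedSpace ℝ H] [CompleteSpace H]
  [NormedAddCommGroup V] [InnerProductSpace 𝕜 V] [CompleteSpace V]

/-- The function `x ^ s` on `[0, M]`. -/
def rpowMap (M : ℝ) {s : ℝ} (hs : 0 ≤ s) : C(Icc 0 M, ℝ) :=
  ⟨fun x => (x : ℝ) ^ s, continuous_subtype_val.rpow_const fun _ => Or.inr hs⟩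

/-- The function `1 / (r + x)` on `[0, M]`. -/
def resolventMap (M : ℝ) {r : ℝ} (hr : 0 < r) : C(Icc 0 M, ℝ) :=
  ⟨fun x => (r + x)⁻¹, (by fun_prop : Continuous fun x : Icc 0 M => r + (x : ℝ)).inv₀
    fun x => by have := x.2.1; positivity⟩

variable {T : H →L[𝕜] H}

theorem contCalc_resolventMap_mul (hT : T.IsPositive) {r : ℝ} (hr : 0 < r) :
    contCalc T (resolventMap ‖T‖ hr) * ((r : 𝕜) • (1 : H →L[𝕜] H) + T) = 1 := by
  have h : ((r : 𝕜) • (1 : H →L[𝕜] H) + T) =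
      contCalc T (r • 1 + (ContinuousMap.id ℝ).restrict (Icc 0 ‖T‖)) := by
    rw [map_add, map_smul, contCalc_one hT, contCalc_id hT, ofReal_smul_clm_eq]
  rw [h, ← contCalc_mul hT, ← contCalc_one hT]
  congr 1
  ext x
  have := x.2.1
  have h0 : r + (x : ℝ) ≠ 0 := by positivity
  simpa [resolventMap] using inv_mul_cancel₀ h0

theorem inverse_eq_contCalc (hT : T.IsPositive) {r : ℝ} (hr : 0 < r) :
    Ring.inverse ((r : 𝕜) • (1 : H →L[𝕜] H) + T) = contCalc T (resolventMap ‖T‖ hr) := by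
  have h1 := contCalc_resolventMap_mul hT hr
  have hc : Commute (contCalc T (resolventMap ‖T‖ hr)) ((r : 𝕜) • (1 : H →L[𝕜] H) + T) := by
    have h2 := contCalc_commute hT (resolventMap ‖T‖ hr)
      ((ContinuousMap.id ℝ).restrict (Icc 0 ‖T‖))
    rw [contCalc_id hT] at h2
    exact ((Commute.one_right _).smul_right _).add_right h2
  have h3 := hc.eq ▸ h1
  exact Ring.inverse_unit (⟨_, _, h3, h1⟩ : (H →L[𝕜] H)ˣ)

/-- The integrand of the Balakrishnan formula for `x ^ s` as a function with values in
`C([0, M])`. -/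
def balakrishnanMap (M s : ℝ) (hs : s ∈ Ioo (0 : ℝ) 1) (r : ℝ) : C(Icc 0 M, ℝ) :=
  if hr : 0 < r then
    ⟨fun x => Real.rpowIntegrand₀₁ s r x,
      ((Real.continuousOn_rpowIntegrand₀₁_Ici hs hr).mono fun _ hx => hx.1).domRestrict⟩
  else 0

theorem balakrishnanMap_apply {M s : ℝ} (hs : s ∈ Ioo (0 : ℝ) 1) {r : ℝ} (hr : 0 < r)
    (x : Icc 0 M) : balakrishnanMap M s hs r x = Real.rpowIntegrand₀₁ s r x := by
  rw [balakrishnanMap, dif_pos hr]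
  rfl

/-- The integrand increases with `x`, so its sup norm on `[0, M]` is controlled by the value at `x =
M`, which is integrable in `r`. -/
theorem integrableOn_balakrishnanMap {M : ℝ} (hM : 0 ≤ M) {s : ℝ} (hs : s ∈ Ioo (0 : ℝ) 1) :
    IntegrableOn (balakrishnanMap M s hs) (Ioi 0) := by
  have hcont : ContinuousOn (balakrishnanMap M s hs) (Ioi 0) := by
    rw [continuousOn_iff_continuous_domRestrict]
    refine ContinuousMap.continuous_of_continuous_uncurry _ ?_
    have h1 := (Real.continuousOn_rpowIntegrand₀₁_uncurry hs (Icc 0 M) fun _ hx => hx.1)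
    have h2 : Continuous fun p : Ioi (0 : ℝ) × Icc 0 M =>
        Real.rpowIntegrand₀₁ s (p.1 : ℝ) (p.2 : ℝ) :=
      h1.comp_continuous (f := fun p : Ioi (0 : ℝ) × Icc 0 M => ((p.1 : ℝ), (p.2 : ℝ)))
        (by fun_prop) fun p => ⟨p.1.2, p.2.2⟩
    refine h2.congr fun p => ?_
    exact (balakrishnanMap_apply hs p.1.2 p.2).symm
  refine (Real.integrableOn_rpowIntegrand₀₁_Ioi hs hM).mono'
    (hcont.aestronglyMeasurable measurableSet_Ioi) ?_
  filter_upwards [ae_restrict_mem measurableSet_Ioi] with r hr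
  have hr' : 0 < r := hr
  rw [ContinuousMap.norm_le _ (Real.rpowIntegrand₀₁_nonneg hs.1 hr'.le hM)]
  intro x
  rw [balakrishnanMap_apply hs hr', Real.norm_of_nonneg
    (Real.rpowIntegrand₀₁_nonneg hs.1 hr'.le x.2.1)]
  exact Real.rpowIntegrand₀₁_monotoneOn hs hr'.le x.2.1 hM x.2.2

/-- The integral is taken in the Banach space `C([0, M])`, where it is evaluated pointwise. Applying
the bounded map `contCalc T` afterwards gives the operator integral in `fracPow`. -/
theorem integral_balakrishnanMap {M : ℝ} (hM : 0 ≤ M) {s : ℝ} (hs : s ∈ Ioo (0 : ℝ) 1) :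
    ∫ r in Ioi (0 : ℝ), balakrishnanMap M s hs r =
      (∫ r in Ioi (0 : ℝ), Real.rpowIntegrand₀₁ s r 1) • rpowMap M hs.1.le := by
  ext x
  rw [ContinuousMap.integral_apply (integrableOn_balakrishnanMap hM hs)]
  rw [setIntegral_congr_fun measurableSet_Ioi
    (fun r hr => balakrishnanMap_apply hs (mem_Ioi.1 hr) x),
    Real.integral_rpowIntegrand₀₁_eq_rpow_mul_const hs x.2.1]
  simp [rpowMap, mul_comm]

theorem contCalc_balakrishnanMap (hT : T.IsPositive) {s : ℝ} (hs : s ∈ Ioo (0 : ℝ) 1) {r : ℝ}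
    (hr : 0 < r) : contCalc T (balakrishnanMap ‖T‖ s hs r) =
      r ^ (s - 1) • (T * Ring.inverse ((r : 𝕜) • (1 : H →L[𝕜] H) + T)) := by
  have : balakrishnanMap ‖T‖ s hs r =
      r ^ (s - 1) • ((ContinuousMap.id ℝ).restrict (Icc 0 ‖T‖) * resolventMap ‖T‖ hr) := by
    ext x
    rw [balakrishnanMap_apply hs hr, Real.rpowIntegrand₀₁_eq_pow_div hs hr.le x.2.1]
    simp [resolventMap, div_eq_mul_inv, mul_assoc]
  rw [this, map_smul, contCalc_mul hT, contCalc_id hT, inverse_eq_contCalc hT hr]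

/-- Up to a positive factor, `fracPow T s` is given by the functional calculus. -/
theorem fracPow_eq_contCalc (hT : T.IsPositive) {s : ℝ} (hs : s ∈ Ioo (0 : ℝ) 1) :
    fracPow T s = (Real.sin (Real.pi * s) / Real.pi *
      ∫ r in Ioi (0 : ℝ), Real.rpowIntegrand₀₁ s r 1) • contCalc T (rpowMap ‖T‖ hs.1.le) := by
  rw [fracPow, setIntegral_congr_fun measurableSet_Ioi
      (fun r hr => (contCalc_balakrishnanMap hT hs (mem_Ioi.1 hr)).symm),
    ContinuousLinearMap.integral_comp_comm _ (integrableOn_balakrishnanMap (norm_nonneg T) hs),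
    integral_balakrishnanMap (norm_nonneg T) hs, map_smul, mul_smul]

theorem rpowMap_pow (M : ℝ) {s t : ℝ} (hs : 0 ≤ s) (ht : 0 ≤ t) (n : ℕ) (h : s * n = t) :
    rpowMap M hs ^ n = rpowMap M ht := by
  ext x
  simp [rpowMap, ← h, Real.rpow_mul x.2.1]

/-- The `4m`-th root of a positive operator, and its relation to `fracPow`. -/
theorem exists_root (hT : T.IsPositive) {n : ℕ} (hn : 1 ≤ n) :
    ∃ B : H →L[𝕜] H, B.IsSymmetric ∧ B ^ n = T ∧
      (∀ r : ℝ, 0 < r → Commute B (Ring.inverse ((r : 𝕜) • (1 : H →L[𝕜] H) + T))) ∧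
      ∀ k : ℕ, 0 < k → k < n → ∃ c : ℝ, 0 < c ∧ fracPow T (k / n) = c • B ^ k := by
  have hn0 : (0 : ℝ) < n := by exact_mod_cast hn
  have h0 : (0 : ℝ) ≤ 1 / n := by positivity
  refine ⟨contCalc T (rpowMap ‖T‖ h0), contCalc_isSymmetric hT _, ?_, fun r hr => ?_,
    fun k hk hkn => ?_⟩
  · rw [← contCalc_pow hT, rpowMap_pow ‖T‖ h0 zero_le_one n (by field_simp)]
    convert contCalc_id hT using 2
    ext x
    simp [rpowMap]
  · rw [inverse_eq_contCalc hT hr]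
    exact contCalc_commute hT _ _
  · have hk0 : (0 : ℝ) < k := by exact_mod_cast hk
    have hs : (k / n : ℝ) ∈ Ioo (0 : ℝ) 1 :=
      ⟨by positivity, by rw [div_lt_one hn0]; exact_mod_cast hkn⟩
    -- Classically this constant equals `1`; its positivity is enough, since it only rescales the
    -- preimages.
    refine ⟨Real.sin (Real.pi * (k / n)) / Real.pi *
      ∫ r in Ioi (0 : ℝ), Real.rpowIntegrand₀₁ (k / n) r 1, ?_, ?_⟩
    · refine mul_pos (div_pos (Real.sin_pos_of_pos_of_lt_pi ?_ ?_) Real.pi_pos)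
        (Real.integral_rpowIntegrand₀₁_one_pos hs)
      · exact mul_pos Real.pi_pos hs.1
      · exact mul_lt_of_lt_one_right Real.pi_pos hs.2
    · rw [fracPow_eq_contCalc hT hs, ← contCalc_pow hT,
        rpowMap_pow ‖T‖ h0 hs.1.le k (by field_simp)]

/-- The operators `T (r + T)⁻¹` are contractions. -/
theorem norm_mul_inverse_le (hT : T.IsPositive) {r : ℝ} (hr : 0 < r) :
    ‖T * Ring.inverse ((r : 𝕜) • (1 : H →L[𝕜] H) + T)‖ ≤ 1 := by
  rw [inverse_eq_contCalc hT hr]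
  nth_rw 1 [← contCalc_id hT]
  rw [← contCalc_mul hT]
  refine (norm_contCalc_le hT _).trans ((ContinuousMap.norm_le _ zero_le_one).2 fun x => ?_)
  have := x.2.1
  have h0 : 0 < r + (x : ℝ) := by positivity
  rw [Real.norm_of_nonneg]
  · simpa [resolventMap, ← div_eq_mul_inv, div_le_one h0] using hr.le
  · simpa [resolventMap] using mul_nonneg this (inv_nonneg.2 h0.le)

end FractionalPowers

/-! ### The embedding `ι`, its polar factor, and strong convergence of the regularisation. -/

section Embedding

variable {𝕜 H V : Type*} [RCLike 𝕜]
  [NormedAddCommGroup H] [InnerProductSpace 𝕜 H] [NormedSpace ℝ H] [CompleteSpace H]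
  [NormedAddCommGroup V] [InnerProductSpace 𝕜 V] [CompleteSpace V]

omit [NormedSpace ℝ H]

theorem formInv_isPositive (ι : V →L[𝕜] H) : (formInv ι).IsPositive :=
  ContinuousLinearMap.isPositive_self_comp_adjoint ι

/-- The closure of the range of `ι*` is the orthogonal complement of the kernel of `ι`. -/
theorem denseRange_adjoint {ι : V →L[𝕜] H} (hinj : Function.Injective ι) :
    DenseRange (ContinuousLinearMap.adjoint ι) := by
  have h := ContinuousLinearMap.orthogonal_range (ContinuousLinearMap.adjoint ι)
  rw [ContinuousLinearMap.adjoint_adjoint, LinearMap.ker_eq_bot.2 hinj,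
    ← Submodule.topologicalClosure_eq_top_iff] at h
  have h2 := congrArg (fun W : Submodule 𝕜 V => (W : Set V)) h
  rw [DenseRange, dense_iff_closure_eq]
  simpa [LinearMap.coe_range] using h2

theorem denseRange_formInv {ι : V →L[𝕜] H} (hinj : Function.Injective ι) (hdense : DenseRange ι) :
    DenseRange (formInv ι) := by
  have := hdense.comp (denseRange_adjoint hinj) ι.continuous
  exact this

/-- If `R` is a symmetric square root of `ι ι*`, then `ι = R U` with a contraction `U`. -/
theorem exists_polar {ι : V →L[𝕜] H} (hinj : Function.Injective ι) {R : H →L[𝕜] H}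
    (hR : R.IsSymmetric) (hRR : R * R = formInv ι) :
    ∃ U : V →L[𝕜] H, (∀ v, ‖U v‖ ≤ ‖v‖) ∧ ∀ v, R (U v) = ι v := by
  have hd := denseRange_adjoint hinj
  set e : H →ₗ[𝕜] V := (ContinuousLinearMap.adjoint ι).toLinearMap with he
  -- In fact `‖R h‖ = ‖ι* h‖`, so `ι* h ↦ R h` is well defined and isometric on a dense subspace;
  -- `U` is its extension.
  have hnorm : ∀ h : H, ‖R.toLinearMap h‖ ≤ 1 * ‖e h‖ := by
    intro h
    have h1 : inner 𝕜 (R h) (R h) =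
        inner 𝕜 (ContinuousLinearMap.adjoint ι h) (ContinuousLinearMap.adjoint ι h) := by
      rw [ContinuousLinearMap.adjoint_inner_left]
      have h3 : R (R h) = ι (ContinuousLinearMap.adjoint ι h) :=
        congrArg (fun A : H →L[𝕜] H => A h) hRR
      rw [← h3]
      exact hR h (R h)
    rw [inner_self_eq_norm_sq_to_K, inner_self_eq_norm_sq_to_K] at h1
    rw [one_mul]
    refine le_of_sq_le_sq (le_of_eq ?_) (norm_nonneg _)
    exact_mod_cast h1
  refine ⟨R.toLinearMap.extendOfNorm e, fun v => ?_, fun v => ?_⟩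
  · simpa using LinearMap.norm_extendOfNorm_apply_le hd 1 hnorm v
  · refine hd.induction_on (p := fun v => R (R.toLinearMap.extendOfNorm e v) = ι v) v
      (isClosed_eq (by fun_prop) (by fun_prop)) fun h => ?_
    have h2 := LinearMap.extendOfNorm_eq (f := R.toLinearMap) (e := e) hd ⟨1, hnorm⟩ h
    have h3 : R (R h) = ι (ContinuousLinearMap.adjoint ι h) :=
      congrArg (fun A : H →L[𝕜] H => A h) hRR
    rw [← h3]
    exact congrArg R h2

open Filter Topology in
/-- Strong convergence `T (r + T)⁻¹ → 1` as `r → 0`. -/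
theorem tendsto_mul_inverse [NormedSpace ℝ H] {T : H →L[𝕜] H} (hT : T.IsPositive)
    (hd : DenseRange T) (x : H) :
    Tendsto (fun n : ℕ => (T * Ring.inverse (((1 / (n + 1) : ℝ) : 𝕜) • (1 : H →L[𝕜] H) + T)) x)
      atTop (𝓝 x) := by
  have hpos : ∀ n : ℕ, (0 : ℝ) < 1 / (n + 1) := fun n => by positivity
  set P : ℕ → H →L[𝕜] H :=
    fun n => T * Ring.inverse (((1 / (n + 1) : ℝ) : 𝕜) • (1 : H →L[𝕜] H) + T) with hP
  have hP1 : ∀ n, ‖P n‖ ≤ 1 := fun n => norm_mul_inverse_le hT (hpos n)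
  -- With `r = 1 / (n + 1)` one has `P n (T y) - T y = -r P n y`. This gives convergence on the
  -- range of `T`, and contractivity extends it to the closure.
  have hPT : ∀ n y, ‖P n (T y) - T y‖ ≤ (1 / (n + 1) : ℝ) * ‖y‖ := by
    intro n y
    have h1 := contCalc_resolventMap_mul hT (hpos n)
    rw [← inverse_eq_contCalc hT (hpos n)] at h1
    have h3 : P n (T y) - T y = -(((1 / (n + 1) : ℝ) : 𝕜) • P n y) := by
      have h4 := congrArg (fun A : H →L[𝕜] H => T (A y)) h1
      simp only [mul_apply_eq_comp, add_apply, smul_apply, one_apply_eq_self, map_add,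
        map_smul] at h4
      rw [sub_eq_iff_eq_add, eq_neg_add_iff_add_eq]
      exact h4
    rw [h3, norm_neg, norm_smul, RCLike.norm_ofReal, abs_of_pos (hpos n)]
    gcongr
    simpa using (P n).le_of_opNorm_le (hP1 n) y
  rw [Metric.tendsto_atTop]
  intro ε hε
  obtain ⟨y, hy⟩ := hd.exists_dist_lt x (show (0 : ℝ) < ε / 3 by positivity)
  have hlim : Tendsto (fun n : ℕ => (1 / (n + 1) : ℝ) * ‖y‖) atTop (𝓝 (0 * ‖y‖)) :=
    tendsto_one_div_add_atTop_nhds_zero_nat.mul_const _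
  rw [zero_mul] at hlim
  obtain ⟨N, hN⟩ := eventually_atTop.1
    (hlim.eventually (gt_mem_nhds (show (0 : ℝ) < ε / 3 by positivity)))
  refine ⟨N, fun n hn => ?_⟩
  rw [dist_eq_norm] at hy ⊢
  have h1 : P n x - x = P n (x - T y) + (P n (T y) - T y) - (x - T y) := by
    rw [map_sub]
    abel
  have h2 : ‖P n (x - T y)‖ ≤ ‖x - T y‖ := by
    simpa using (P n).le_of_opNorm_le (hP1 n) (x - T y)
  change ‖P n x - x‖ < ε
  rw [h1]
  have := (norm_sub_le (P n (x - T y) + (P n (T y) - T y)) (x - T y)).trans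
    (add_le_add_left (norm_add_le _ _) _)
  linarith [hPT n y, hN n hn]

end Embedding

/-! ### Integration by parts for primitives of integrable functions. -/

section ProductRule

variable {E F G : Type*} [NormedAddCommGroup E] [NormedSpace ℝ E]
  [NormedAddCommGroup F] [NormedSpace ℝ F] [NormedAddCommGroup G] [NormedSpace ℝ G]

theorem integrableOn_bilin_of_continuousOn (L : E →L[ℝ] F →L[ℝ] G) {b : ℝ}
    {x : ℝ → E} {Y : ℝ → F} (hx : IntegrableOn x (Ioc 0 b)) (hY : ContinuousOn Y (Icc 0 b)) :
    IntegrableOn (fun t => L (x t) (Y t)) (Ioc 0 b) := by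
  obtain ⟨C, hC⟩ := isCompact_Icc.exists_bound_of_continuousOn hY
  have hYm : AEStronglyMeasurable Y (volume.restrict (Ioc 0 b)) :=
    (hY.mono Ioc_subset_Icc_self).aestronglyMeasurable measurableSet_Ioc
  have hmeas : AEStronglyMeasurable (fun t => L (x t) (Y t)) (volume.restrict (Ioc 0 b)) :=
    L.aestronglyMeasurable_comp₂ hx.1 hYm
  refine (hx.norm.const_mul (‖L‖ * C)).mono' hmeas ?_
  filter_upwards [ae_restrict_mem measurableSet_Ioc] with t ht
  calc ‖L (x t) (Y t)‖ ≤ ‖L‖ * ‖x t‖ * ‖Y t‖ := L.le_opNorm₂ _ _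
    _ ≤ ‖L‖ * ‖x t‖ * C := by gcongr; exact hC t (Ioc_subset_Icc_self ht)
    _ = ‖L‖ * C * ‖x t‖ := by ring

variable [CompleteSpace E] [CompleteSpace F] [CompleteSpace G]

/-- Fubini on the square `(0, b]²`, cut along the diagonal into two triangles. -/
theorem bilin_integral_integral (L : E →L[ℝ] F →L[ℝ] G) {b : ℝ} {x : ℝ → E} {y : ℝ → F}
    (hx : IntegrableOn x (Ioc 0 b)) (hy : IntegrableOn y (Ioc 0 b)) :
    L (∫ t in Ioc 0 b, x t) (∫ t in Ioc 0 b, y t) =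
      (∫ t in Ioc 0 b, L (∫ s in Ioc 0 t, x s) (y t)) +
        ∫ t in Ioc 0 b, L (x t) (∫ s in Ioc 0 t, y s) := by
  set μ : Measure ℝ := volume.restrict (Ioc 0 b) with hμ
  set g : ℝ × ℝ → G := fun z => L (x z.1) (y z.2) with hg
  have hgi : Integrable g (μ.prod μ) :=
    Integrable.op_fst_snd (op := fun u v => L u v) (by fun_prop) ⟨‖L‖, L.le_opNorm₂⟩ hx hy
  have hS : MeasurableSet {z : ℝ × ℝ | z.1 ≤ z.2} := measurableSet_le measurable_fst measurable_snd
  rw [← integral_prod_bilin L hx hy, ← integral_add_compl hS hgi, ← integral_indicator hS,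
    ← integral_indicator hS.compl, integral_prod_symm _ (hgi.indicator hS),
    integral_prod _ (hgi.indicator hS.compl)]
  congr 1
  · refine setIntegral_congr_fun measurableSet_Ioc fun t ht => ?_
    have h1 : (fun s => {z : ℝ × ℝ | z.1 ≤ z.2}.indicator g (s, t)) =
        (Iic t).indicator fun s => L (x s) (y t) := by
      ext s
      simp [indicator, hg]
    have h2 : Iic t ∩ Ioc 0 b = Ioc 0 t := by
      ext s; simp only [mem_inter_iff, mem_Iic, mem_Ioc]
      have := ht.2
      constructor
      · rintro ⟨h, h', _⟩; exact ⟨h', h⟩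
      · rintro ⟨h, h'⟩; exact ⟨h', h, h'.trans this⟩
    have h3 : IntegrableOn x (Ioc 0 t) := hx.mono_set (Ioc_subset_Ioc_right ht.2)
    rw [h1, integral_indicator measurableSet_Iic, hμ, Measure.restrict_restrict measurableSet_Iic,
      h2]
    exact (L.flip (y t)).integral_comp_comm h3
  · refine setIntegral_congr_fun measurableSet_Ioc fun s hs => ?_
    have h1 : (fun t => {z : ℝ × ℝ | z.1 ≤ z.2}ᶜ.indicator g (s, t)) =
        (Iio s).indicator fun t => L (x s) (y t) := by
      ext t
      simp [indicator, hg]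
    have h2 : Iio s ∩ Ioc 0 b = Ioo 0 s := by
      ext t; simp only [mem_inter_iff, mem_Iio, mem_Ioc, mem_Ioo]
      have := hs.2
      constructor
      · rintro ⟨h, h', _⟩; exact ⟨h', h⟩
      · rintro ⟨h, h'⟩; exact ⟨h', h, h'.le.trans this⟩
    have h3 : IntegrableOn y (Ioc 0 s) := hy.mono_set (Ioc_subset_Ioc_right hs.2)
    rw [h1, integral_indicator measurableSet_Iio, hμ, Measure.restrict_restrict measurableSet_Iio,
      h2, ← integral_Ioc_eq_integral_Ioo]
    exact (L (x s)).integral_comp_comm h3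

/-- Product rule for primitives of integrable functions. -/
theorem integral_product_rule (L : E →L[ℝ] F →L[ℝ] G) {b : ℝ} (hb : 0 ≤ b)
    {x X : ℝ → E} {y Y : ℝ → F}
    (hx : IntervalIntegrable x volume 0 b) (hy : IntervalIntegrable y volume 0 b)
    (hX : ∀ t ∈ Icc 0 b, X t = X 0 + ∫ s in 0..t, x s)
    (hY : ∀ t ∈ Icc 0 b, Y t = Y 0 + ∫ s in 0..t, y s) :
    (∫ t in 0..b, L (X t) (y t)) + ∫ t in 0..b, L (x t) (Y t) =
      L (X b) (Y b) - L (X 0) (Y 0) := by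
  have hx' : IntegrableOn x (Ioc 0 b) := (intervalIntegrable_iff_integrableOn_Ioc_of_le hb).1 hx
  have hy' : IntegrableOn y (Ioc 0 b) := (intervalIntegrable_iff_integrableOn_Ioc_of_le hb).1 hy
  have hXc : ContinuousOn (fun t => ∫ s in 0..t, x s) (Icc 0 b) :=
    intervalIntegral.continuousOn_primitive_interval' hx (by simp) |>.mono (by rw [uIcc_of_le hb])
  have hYc : ContinuousOn (fun t => ∫ s in 0..t, y s) (Icc 0 b) :=
    intervalIntegral.continuousOn_primitive_interval' hy (by simp) |>.mono (by rw [uIcc_of_le hb])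
  have e1 : (∫ t in 0..b, L (X t) (y t)) =
      L (X 0) (∫ t in Ioc 0 b, y t) + ∫ t in Ioc 0 b, L (∫ s in Ioc 0 t, x s) (y t) := by
    rw [intervalIntegral.integral_of_le hb, ← (L (X 0)).integral_comp_comm hy', ← integral_add]
    · refine setIntegral_congr_fun measurableSet_Ioc fun t ht => ?_
      rw [hX t (Ioc_subset_Icc_self ht), intervalIntegral.integral_of_le ht.1.le, map_add,
        add_apply]
    · exact (L (X 0)).integrable_comp hy'
    · refine (integrableOn_bilin_of_continuousOn L.flip hy' hXc).congr_fun (fun t ht => ?_)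
        measurableSet_Ioc
      simp [intervalIntegral.integral_of_le ht.1.le]
  have e2 : (∫ t in 0..b, L (x t) (Y t)) =
      L (∫ t in Ioc 0 b, x t) (Y 0) + ∫ t in Ioc 0 b, L (x t) (∫ s in Ioc 0 t, y s) := by
    have := (L.flip (Y 0)).integral_comp_comm hx'
    simp only [ContinuousLinearMap.flip_apply] at this
    rw [intervalIntegral.integral_of_le hb, ← this, ← integral_add]
    · refine setIntegral_congr_fun measurableSet_Ioc fun t ht => ?_
      rw [hY t (Ioc_subset_Icc_self ht), intervalIntegral.integral_of_le ht.1.le, map_add]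
    · exact (L.flip (Y 0)).integrable_comp hx'
    · refine (integrableOn_bilin_of_continuousOn L hx' hYc).congr_fun (fun t ht => ?_)
        measurableSet_Ioc
      simp [intervalIntegral.integral_of_le ht.1.le]
  have e3 := bilin_integral_integral L hx' hy'
  rw [e1, e2, hX b ⟨hb, le_rfl⟩, hY b ⟨hb, le_rfl⟩, intervalIntegral.integral_of_le hb,
    intervalIntegral.integral_of_le hb]
  simp only [map_add, add_apply, e3]
  abel

end ProductRule

/-! ### Test functions on `(0, τ)`. -/

section TestFunctions

theorem isOpen_openI (τ : EReal) : IsOpen (openI τ) :=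
  (isOpen_lt continuous_const continuous_id).inter
    (isOpen_lt continuous_coe_real_ereal continuous_const)

theorem openI_subset_closedI (τ : EReal) : openI τ ⊆ closedI τ := fun _ ht => ⟨ht.1.le, ht.2.le⟩

theorem Icc_subset_closedI {τ : EReal} {b : ℝ} (hb : b ∈ closedI τ) : Icc 0 b ⊆ closedI τ :=
  fun _ ht => ⟨ht.1, (EReal.coe_le_coe_iff.2 ht.2).trans hb.2⟩

theorem Ioo_subset_openI {τ : EReal} {b : ℝ} (hb : b ∈ closedI τ) : Ioo 0 b ⊆ openI τ :=
  fun _ ht => ⟨ht.1, (EReal.coe_lt_coe_iff.2 ht.2).trans_le hb.2⟩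

theorem openI_nonempty {τ : EReal} (hτ : 0 < τ) : (openI τ).Nonempty := by
  obtain ⟨b, h0, hb⟩ := EReal.lt_iff_exists_real_btwn.1 hτ
  exact ⟨b, by exact_mod_cast h0, hb⟩

/-- Test functions on `I`. -/
structure IsTest (I : Set ℝ) (φ : ℝ → ℝ) : Prop where
  contDiff : ContDiff ℝ ∞ φ
  hasCompactSupport : HasCompactSupport φ
  tsupport_subset : tsupport φ ⊆ I

variable {I : Set ℝ} {φ ψ : ℝ → ℝ} {τ : EReal}

theorem IsTest.deriv (h : IsTest I φ) : IsTest I (deriv φ) :=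
  ⟨(contDiff_infty_iff_deriv.1 h.contDiff).2, h.hasCompactSupport.deriv,
    tsupport_deriv_subset.trans h.tsupport_subset⟩

theorem IsTest.iteratedDeriv (h : IsTest I φ) (n : ℕ) : IsTest I (iteratedDeriv n φ) := by
  induction n with
  | zero => simpa using h
  | succ n ih =>
    rw [iteratedDeriv_succ]
    exact ih.deriv

theorem IsTest.const_mul (h : IsTest I φ) (c : ℝ) : IsTest I fun t => c * φ t :=
  ⟨contDiff_const.mul h.contDiff, h.hasCompactSupport.mul_left,
    (closure_mono fun _ ht => right_ne_zero_of_mul ht).trans h.tsupport_subset⟩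

theorem IsTest.sub (h : IsTest I φ) (h' : IsTest I ψ) : IsTest I fun t => φ t - ψ t :=
  ⟨h.contDiff.sub h'.contDiff, h.hasCompactSupport.sub h'.hasCompactSupport,
    (tsupport_sub φ ψ).trans (union_subset h.tsupport_subset h'.tsupport_subset)⟩

theorem IsTest.integrable (h : IsTest I φ) : Integrable φ :=
  h.contDiff.continuous.integrable_of_hasCompactSupport h.hasCompactSupport

theorem IsTest.eq_zero (h : IsTest I φ) {t : ℝ} (ht : t ∉ I) : φ t = 0 :=
  image_eq_zero_of_notMem_tsupport fun h' => ht (h.tsupport_subset h')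

/-- Since `b` may be taken strictly to the right of the support, no boundary term arises there, and
the case `τ = ∞` reduces to a bounded interval. -/
theorem IsTest.exists_Icc (h : IsTest (openI τ) φ) (hτ : 0 < τ) :
    ∃ a b : ℝ, 0 < a ∧ a ≤ b ∧ b ∈ openI τ ∧ tsupport φ ⊆ Icc a b ∧ φ b = 0 := by
  rcases (tsupport φ).eq_empty_or_nonempty with he | hne
  · obtain ⟨b, hb⟩ := openI_nonempty hτ
    exact ⟨b, b, hb.1, le_rfl, hb, by simp [he],
      image_eq_zero_of_notMem_tsupport (by simp [he])⟩
  · have hK : IsCompact (tsupport φ) := h.hasCompactSupport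
    have h1 := h.tsupport_subset (hK.sInf_mem hne)
    have h2 := h.tsupport_subset (hK.sSup_mem hne)
    obtain ⟨b, hb1, hb2⟩ := EReal.lt_iff_exists_real_btwn.1 h2.2
    have hb1' : sSup (tsupport φ) < b := EReal.coe_lt_coe_iff.1 hb1
    have h3 : sInf (tsupport φ) ≤ sSup (tsupport φ) :=
      csInf_le hK.bddBelow (hK.sSup_mem hne)
    refine ⟨sInf (tsupport φ), b, h1.1, (h3.trans_lt hb1').le, ⟨h2.1.trans hb1', hb2⟩,
      fun t ht => ⟨csInf_le hK.bddBelow ht, (le_csSup hK.bddAbove ht).trans hb1'.le⟩, ?_⟩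
    exact image_eq_zero_of_notMem_tsupport fun hb => absurd (le_csSup hK.bddAbove hb) hb1'.not_ge

/-- A test function with vanishing integral is the derivative of a test function. -/
theorem IsTest.exists_primitive (h : IsTest (openI τ) φ) (hτ : 0 < τ) (hφ : ∫ t, φ t = 0) :
    ∃ χ, IsTest (openI τ) χ ∧ _root_.deriv χ = φ := by
  obtain ⟨a, b, ha, hab, hb, hsub, -⟩ := h.exists_Icc hτ
  have hc := h.contDiff.continuous
  have hd : ∀ t, HasDerivAt (fun t => ∫ s in 0..t, φ s) (φ t) t := fun t =>
    hc.integral_hasStrictDerivAt 0 t |>.hasDerivAt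
  have hder : _root_.deriv (fun t => ∫ s in 0..t, φ s) = φ := funext fun t => (hd t).deriv
  have hz : ∀ t, t ∉ Icc a b → φ t = 0 := fun t ht =>
    image_eq_zero_of_notMem_tsupport fun h' => ht (hsub h')
  have hsupp : tsupport (fun t => ∫ s in 0..t, φ s) ⊆ Icc a b := by
    refine closure_minimal (fun t ht => ?_) isClosed_Icc
    by_contra hn
    refine ht ?_
    change ∫ s in 0..t, φ s = 0
    rcases lt_or_ge t a with hta | hta
    · rw [intervalIntegral.integral_congr (g := fun _ => (0 : ℝ)), intervalIntegral.integral_zero]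
      intro s hs
      refine hz s fun hs' => ?_
      have : s ≤ max 0 t := hs.2
      have := this.trans_lt (max_lt ha hta)
      exact absurd hs'.1 this.not_ge
    · have htb : b < t := not_le.1 fun h' => hn ⟨hta, h'⟩
      rw [intervalIntegral.integral_of_le (ha.le.trans hta)]
      refine Eq.trans ?_ hφ
      refine setIntegral_eq_integral_of_forall_compl_eq_zero fun s hs => hz s fun hs' => hs ?_
      exact ⟨ha.trans_le hs'.1, hs'.2.trans htb.le⟩
  refine ⟨fun t => ∫ s in 0..t, φ s,
    ⟨?_, HasCompactSupport.intro (isCompact_Icc (a := a) (b := b)) fun t ht => ?_, ?_⟩, hder⟩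
  · rw [contDiff_infty_iff_deriv, hder]
    exact ⟨fun t => (hd t).differentiableAt, h.contDiff⟩
  · exact image_eq_zero_of_notMem_tsupport (f := fun t => ∫ s in 0..t, φ s)
      fun h' => ht (hsupp h')
  · exact hsupp.trans fun t ht => ⟨ha.trans_le ht.1, (EReal.coe_le_coe_iff.2 ht.2).trans_lt hb.2⟩

theorem exists_isTest_integral_eq_one (hI : IsOpen I) (hne : I.Nonempty) :
    ∃ ψ, IsTest I ψ ∧ ∫ t, ψ t = 1 := by
  obtain ⟨x, hx⟩ := hne
  obtain ⟨f, h1, h2, h3, h4, h5⟩ := exists_contDiff_tsupport_subset (n := ⊤) (hI.mem_nhds hx)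
  have hpos : 0 < ∫ t, f t := h3.continuous.integral_pos_of_hasCompactSupport_nonneg_nonzero h2
    (fun t => (h4 ⟨t, rfl⟩).1) (x := x) (by simp [h5])
  refine ⟨_, IsTest.const_mul ⟨h3, h2, h1⟩ (∫ t, f t)⁻¹, ?_⟩
  rw [integral_const_mul, inv_mul_cancel₀ hpos.ne']

variable {E : Type*} [NormedAddCommGroup E] [NormedSpace ℝ E]

theorem IsTest.integrableOn_smul (h : IsTest I φ) {u : ℝ → E} (hu : LocallyIntegrableOn u I) :
    IntegrableOn (fun t => φ t • u t) I := by
  have h1 : IntegrableOn (fun t => φ t • u t) (tsupport φ) :=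
    (hu.integrableOn_compact_subset h.tsupport_subset h.hasCompactSupport).continuousOn_smul
      h.contDiff.continuous.continuousOn h.hasCompactSupport
  refine (h1.integrable_of_forall_notMem_eq_zero fun t ht => ?_).integrableOn
  rw [image_eq_zero_of_notMem_tsupport ht, zero_smul]

/-- Product rule on `[0, b]`; the boundary terms vanish because `φ 0 = φ b = 0`. -/
theorem IsTest.integral_deriv_smul [CompleteSpace E] (h : IsTest (openI τ) φ) (hτ : 0 < τ)
    {G F : ℝ → E}
    (hF : ∀ b ∈ closedI τ, IntervalIntegrable F volume 0 b)
    (hG : ∀ t ∈ closedI τ, G t = G 0 + ∫ s in 0..t, F s) :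
    ∫ t in openI τ, _root_.deriv φ t • G t = -∫ t in openI τ, φ t • F t := by
  obtain ⟨a, b, ha, hab, hb, hsub, hφb⟩ := h.exists_Icc hτ
  have hb0 : 0 < b := ha.trans_le hab
  have hbI := openI_subset_closedI τ hb
  have hc : Continuous (_root_.deriv φ) := h.deriv.contDiff.continuous
  have hφ0 : φ 0 = 0 := h.eq_zero fun h' => lt_irrefl _ h'.1
  have hset : ∀ (χ : ℝ → ℝ) (w : ℝ → E), tsupport χ ⊆ Icc a b →
      ∫ t in openI τ, χ t • w t = ∫ t in 0..b, χ t • w t := by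
    intro χ w hχ
    have hz : ∀ t, t ∉ Icc a b → χ t • w t = 0 := fun t ht => by
      rw [image_eq_zero_of_notMem_tsupport fun h' => ht (hχ h'), zero_smul]
    rw [intervalIntegral.integral_of_le hb0.le,
      setIntegral_eq_integral_of_forall_compl_eq_zero fun t ht => hz t fun ht' => ht ?_,
      setIntegral_eq_integral_of_forall_compl_eq_zero fun t ht => hz t fun ht' => ht ?_]
    · exact ⟨ha.trans_le ht'.1, ht'.2⟩
    · exact ⟨ha.trans_le ht'.1, (EReal.coe_le_coe_iff.2 ht'.2).trans_lt hb.2⟩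
  have key := integral_product_rule (ContinuousLinearMap.lsmul ℝ ℝ : ℝ →L[ℝ] E →L[ℝ] E) hb0.le
    (x := _root_.deriv φ) (X := φ) (y := F) (Y := G) (hc.intervalIntegrable _ _) (hF b hbI)
    (fun t _ => by
      rw [intervalIntegral.integral_deriv_eq_sub
        (fun x _ => (h.contDiff.differentiable (by simp)).differentiableAt)
        (hc.intervalIntegrable _ _)]
      ring)
    (fun t ht => hG t (Icc_subset_closedI hbI ht))
  simp only [ContinuousLinearMap.lsmul_apply, hφ0, hφb, zero_smul, sub_zero] at key
  rw [hset _ _ (tsupport_deriv_subset.trans hsub), hset _ _ hsub]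
  exact eq_neg_of_add_eq_zero_right key

theorem continuousOn_primitive_closedI {F : ℝ → E}
    (hF : ∀ b ∈ closedI τ, IntervalIntegrable F volume 0 b) :
    ContinuousOn (fun t => ∫ s in 0..t, F s) (closedI τ) := by
  intro t ht
  rcases ht.2.lt_or_eq with hlt | heq
  · obtain ⟨b, hb1, hb2⟩ := EReal.lt_iff_exists_real_btwn.1 hlt
    have hb1' : t < b := EReal.coe_lt_coe_iff.1 hb1
    have hb0 := ht.1.trans hb1'.le
    have hc := intervalIntegral.continuousOn_primitive_interval' (hF b ⟨hb0, hb2.le⟩)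
      (a := 0) (by simp)
    rw [uIcc_of_le hb0] at hc
    refine (hc t ⟨ht.1, hb1'.le⟩).mono_of_mem_nhdsWithin ?_
    filter_upwards [self_mem_nhdsWithin, mem_nhdsWithin_of_mem_nhds (Iio_mem_nhds hb1')]
      with s h1 h2
    exact ⟨h1.1, h2.le⟩
  -- Here `τ = t` is finite, so `closedI τ` lies in `[0, t]` and one-sided continuity suffices.
  · have hc := intervalIntegral.continuousOn_primitive_interval' (hF t ht) (a := 0) (by simp)
    rw [uIcc_of_le ht.1] at hc
    refine (hc t ⟨ht.1, le_rfl⟩).mono fun s hs => ⟨hs.1, ?_⟩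
    have := hs.2
    rw [← heq] at this
    exact EReal.coe_le_coe_iff.1 this

end TestFunctions

/-! ### From the weak `m`-th derivative to continuous lower derivatives. -/

section Chain

variable {E : Type*} [NormedAddCommGroup E] [NormedSpace ℝ E] {τ : EReal}

theorem integrableOn_test_mul_iteratedDeriv {I : Set ℝ} {φ : ℝ → ℝ} (h : IsTest I φ) {u : ℝ → E}
    (hu : LocallyIntegrableOn u I) (n : ℕ) :
    IntegrableOn (fun t => iteratedDeriv n φ t • u t) I :=
  (h.iteratedDeriv n).integrableOn_smul hu

variable [CompleteSpace E]

/-- An `(n+1)`-st weak derivative `F` of `u` which is integrable near `0` has a primitive which is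
an `n`-th weak derivative of `u`. -/
theorem exists_isWeakDeriv_primitive (hτ : 0 < τ) {n : ℕ} {u F : ℝ → E}
    (h : IsWeakDeriv (openI τ) (n + 1) u F)
    (hF : ∀ b ∈ closedI τ, IntervalIntegrable F volume 0 b) :
    ∃ c : E, IsWeakDeriv (openI τ) n u fun t => (∫ s in 0..t, F s) + c := by
  obtain ⟨hu, hFl, hweak⟩ := h
  obtain ⟨ψ, hψ, hψ1⟩ := exists_isTest_integral_eq_one (isOpen_openI τ) (openI_nonempty hτ)
  have hmeas : MeasurableSet (openI τ) := (isOpen_openI τ).measurableSet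
  set G : ℝ → E := fun t => ∫ s in 0..t, F s with hG
  have hGc : ContinuousOn G (openI τ) :=
    (continuousOn_primitive_closedI hF).mono (openI_subset_closedI τ)
  have hGl : LocallyIntegrableOn G (openI τ) := hGc.locallyIntegrableOn hmeas
  set C : E := ∫ t in openI τ, iteratedDeriv n ψ t • u t with hC
  -- The only possible constant: test the desired identity with `ψ`, whose integral is `1`.
  set c : E := (-1 : ℝ) ^ n • C - ∫ t in openI τ, ψ t • G t with hc
  refine ⟨c, hu, (hGc.add continuousOn_const).locallyIntegrableOn hmeas, fun φ h1 h2 h3 => ?_⟩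
  have hφ : IsTest (openI τ) φ := ⟨h1, h2, h3⟩
  have hset : ∫ t in openI τ, φ t = ∫ t, φ t :=
    setIntegral_eq_integral_of_forall_compl_eq_zero fun t ht => hφ.eq_zero ht
  set q : ℝ := ∫ t, φ t with hq
  -- As `φ - q ψ` has mean zero it is some `χ'`. Testing the hypothesis of order `n + 1` with `χ`
  -- gives the identity of order `n` for `φ`.
  obtain ⟨χ, hχ, hχd⟩ := (hφ.sub (hψ.const_mul q)).exists_primitive hτ (by
    rw [integral_sub hφ.integrable (hψ.const_mul q).integrable, integral_const_mul, hψ1, mul_one,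
      sub_self])
  have e1 : ∫ t in openI τ, φ t • (G t + c) = (∫ t in openI τ, φ t • G t) + q • c := by
    have : ∀ t, φ t • (G t + c) = φ t • G t + φ t • c := fun t => smul_add _ _ _
    simp only [this]
    rw [integral_add (hφ.integrableOn_smul hGl) (hφ.integrable.integrableOn.smul_const c),
      integral_smul_const, hset]
  have e2 : ∫ t in openI τ, iteratedDeriv (n + 1) χ t • u t =
      (∫ t in openI τ, iteratedDeriv n φ t • u t) - q • C := by
    have : ∀ t, iteratedDeriv (n + 1) χ t • u t =
        iteratedDeriv n φ t • u t - q • iteratedDeriv n ψ t • u t := by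
      intro t
      rw [iteratedDeriv_succ', hχd, iteratedDeriv_fun_sub
        (contDiff_infty.1 hφ.contDiff n).contDiffAt
        (contDiff_infty.1 (hψ.const_mul q).contDiff n).contDiffAt, iteratedDeriv_const_mul_field,
        sub_smul, mul_smul]
    simp only [this]
    have hi : IntegrableOn (fun t => q • iteratedDeriv n ψ t • u t) (openI τ) :=
      (integrableOn_test_mul_iteratedDeriv hψ hu n).smul q
    rw [integral_sub (integrableOn_test_mul_iteratedDeriv hφ hu n) hi, integral_smul]
  have e3 : ∫ t in openI τ, χ t • F t =
      q • (∫ t in openI τ, ψ t • G t) - ∫ t in openI τ, φ t • G t := by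
    have h4 := hχ.integral_deriv_smul hτ hF (G := G) (fun t _ => by simp [hG])
    have : ∀ t, deriv χ t • G t = φ t • G t - q • ψ t • G t := by
      intro t
      rw [hχd, sub_smul, mul_smul]
    simp only [this] at h4
    have hi : IntegrableOn (fun t => q • ψ t • G t) (openI τ) :=
      (hψ.integrableOn_smul hGl).smul q
    rw [integral_sub (hφ.integrableOn_smul hGl) hi, integral_smul] at h4
    rw [← neg_sub, h4, neg_neg]
  have e4 := hweak χ hχ.contDiff hχ.hasCompactSupport hχ.tsupport_subset
  rw [e2, e3, sub_eq_iff_eq_add] at e4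
  rw [e4, e1, hc, pow_succ]
  have h5 : (-1 : ℝ) ^ n * (-1 : ℝ) ^ n = 1 := by
    rw [← mul_pow]
    simp
  simp only [smul_add, smul_sub, smul_smul]
  rw [mul_left_comm ((-1 : ℝ) ^ n) q ((-1) ^ n), h5]
  module

/-- The chain of the derivatives of order at most `m` of a function with a weak `m`-th derivative:
each is a primitive of the next one. -/
theorem exists_derivative_chain (hτ : 0 < τ) (m : ℕ) : ∀ {u F : ℝ → E},
    IsWeakDeriv (openI τ) m u F → (∀ b ∈ closedI τ, IntervalIntegrable F volume 0 b) →
    ∃ D : ℕ → ℝ → E, D m = F ∧ (∀ j ≤ m, IsWeakDeriv (openI τ) j u (D j)) ∧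
      ∀ j < m, ContinuousOn (D j) (closedI τ) ∧
        ∀ t ∈ closedI τ, D j t = D j 0 + ∫ s in 0..t, D (j + 1) s := by
  induction m with
  | zero =>
    intro u F h _
    refine ⟨fun _ => F, rfl, fun j hj => ?_, fun j hj => absurd hj (Nat.not_lt_zero j)⟩
    rwa [Nat.le_zero.1 hj]
  | succ m ih =>
    intro u F h hF
    obtain ⟨c, hc⟩ := exists_isWeakDeriv_primitive hτ h hF
    have hcont : ContinuousOn (fun t => (∫ s in 0..t, F s) + c) (closedI τ) :=
      (continuousOn_primitive_closedI hF).add continuousOn_const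
    obtain ⟨D, hDm, hDw, hDc⟩ := ih hc fun b hb => by
      refine (hcont.mono ?_).intervalIntegrable
      rw [uIcc_of_le hb.1]
      exact Icc_subset_closedI hb
    refine ⟨Function.update D (m + 1) F, by simp, fun j hj => ?_, fun j hj => ?_⟩
    · rcases hj.lt_or_eq with hj | rfl
      · rw [Function.update_of_ne hj.ne]
        exact hDw j (Nat.lt_succ_iff.1 hj)
      · simpa using h
    · rw [Function.update_of_ne hj.ne]
      rcases (Nat.lt_succ_iff.1 hj).lt_or_eq with hj' | rfl
      · rw [Function.update_of_ne (by omega)]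
        exact hDc j hj'
      · rw [Function.update_self, hDm]
        exact ⟨hcont, fun t _ => by simp [add_comm]⟩

theorem ae_eq_of_isWeakDeriv_zero {u w : ℝ → E}
    (h : IsWeakDeriv (openI τ) 0 u w) : u =ᵐ[volume.restrict (openI τ)] w := by
  obtain ⟨hu, hw, h⟩ := h
  rw [Filter.EventuallyEq, ae_restrict_iff' (isOpen_openI τ).measurableSet]
  have := (isOpen_openI τ).ae_eq_zero_of_integral_contDiff_smul_eq_zero (hu.sub hw)
    fun φ h1 h2 h3 => by
      have hφ : IsTest (openI τ) φ := ⟨h1, h2, h3⟩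
      have h4 := h φ h1 h2 h3
      rw [← setIntegral_eq_integral_of_forall_compl_eq_zero (s := openI τ) fun t ht => by
        rw [hφ.eq_zero ht, zero_smul]]
      simp only [Pi.sub_apply, smul_sub]
      rw [integral_sub (hφ.integrableOn_smul hu) (hφ.integrableOn_smul hw), sub_eq_zero]
      simpa using h4
  filter_upwards [this] with t ht htI
  exact sub_eq_zero.1 (ht htI)

end Chain

/-! ### Closing the system of energy inequalities. -/

section Sequences

/-- A discrete maximum principle for sequences that are log-convex up to a factor. The second
difference of `j²` is `2`, so the weight `8 ^ j²` turns the factor `16` into `16 / 64 = 1 / 4`. An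
interior maximum `y` of the weighted sequence then satisfies `y² ≤ y² / 4`, hence vanishes. -/
theorem le_of_sq_le_mul {a : ℕ → ℝ} {m : ℕ} {M : ℝ} (ha : ∀ j, 0 ≤ a j)
    (h : ∀ i, i + 2 ≤ m → a (i + 1) ^ 2 ≤ 16 * (a i * a (i + 2))) (h0 : a 0 ≤ M) (hm : a m ≤ M)
    {j : ℕ} (hj : j ≤ m) : a j ≤ 8 ^ m ^ 2 * M := by
  have hM : 0 ≤ M := (ha 0).trans h0
  obtain ⟨k, hk, hmax⟩ := Finset.exists_max_image (Finset.range (m + 1))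
    (fun j => (8 : ℝ) ^ j ^ 2 * a j) ⟨0, by simp⟩
  have hkm : k ≤ m := Nat.lt_succ_iff.1 (Finset.mem_range.1 hk)
  have hk' : (8 : ℝ) ^ k ^ 2 * a k ≤ 8 ^ m ^ 2 * M := by
    rcases k with _ | i
    · have : (1 : ℝ) ≤ 8 ^ m ^ 2 := one_le_pow₀ (by norm_num)
      simp only [ne_eq, OfNat.ofNat_ne_zero, not_false_eq_true, zero_pow, pow_zero, one_mul]
      nlinarith
    · rcases hkm.lt_or_eq with hlt | heq
      · have h1 := h i hlt
        have hi := hmax i (by simp; omega)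
        have hi2 := hmax (i + 2) (by simp; omega)
        set y := (8 : ℝ) ^ (i + 1) ^ 2 * a (i + 1) with hy
        have hy0 : 0 ≤ y := mul_nonneg (by positivity) (ha _)
        have h2 : y ^ 2 ≤ (1 / 4) * y ^ 2 := by
          calc y ^ 2 = (8 ^ (i + 1) ^ 2) ^ 2 * a (i + 1) ^ 2 := by rw [hy]; ring
            _ ≤ (8 ^ (i + 1) ^ 2) ^ 2 * (16 * (a i * a (i + 2))) := by gcongr
            _ = (1 / 4) * ((8 ^ i ^ 2 * a i) * (8 ^ (i + 2) ^ 2 * a (i + 2))) := by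
              have : (i + 2) ^ 2 = 4 * i + 4 + i ^ 2 := by ring
              have h' : (i + 1) ^ 2 = 2 * i + 1 + i ^ 2 := by ring
              rw [this, h']
              ring
            _ ≤ (1 / 4) * (y * y) := by
              have := ha (i + 2)
              gcongr
            _ = (1 / 4) * y ^ 2 := by ring
        have h3 : y = 0 := by
          have : y ^ 2 = 0 := le_antisymm (by linarith) (sq_nonneg y)
          exact pow_eq_zero_iff (two_ne_zero) |>.1 this
        rw [h3]
        positivity
      · rw [heq]
        gcongr
  have h1 : (1 : ℝ) ≤ 8 ^ j ^ 2 := one_le_pow₀ (by norm_num)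
  calc a j ≤ 8 ^ j ^ 2 * a j := le_mul_of_one_le_left (ha j) h1
    _ ≤ 8 ^ k ^ 2 * a k := hmax j (by simp; omega)
    _ ≤ _ := hk'

/-- Adding `N` to each `e i` absorbs the initial terms, so that `s i ^ 2` is at most twice a product
of neighbours of the shifted sequence. Then the `s i` can be eliminated from `h2`, leaving the
approximate log-convexity of `le_of_sq_le_mul`. -/
theorem le_of_energy_inequalities {e s p : ℕ → ℝ} {m : ℕ}
    (he : ∀ j, 0 ≤ e j) (hp : ∀ j, 0 ≤ p j)
    (h1 : ∀ j < m, s j ^ 2 ≤ p j ^ 2 + 2 * (e j * e (j + 1)))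
    (h2 : ∀ i, i + 2 ≤ m →
      e (i + 1) ^ 2 ≤ e i * e (i + 2) + s i * s (i + 1) + p i * p (i + 1))
    {j : ℕ} (hj : j < m) :
    s j ≤ 4 * 8 ^ m ^ 2 * (e 0 + e m + ∑ i ∈ Finset.range m, p i) := by
  set N := e 0 + e m + ∑ i ∈ Finset.range m, p i with hN
  have hpsum : 0 ≤ ∑ i ∈ Finset.range m, p i := Finset.sum_nonneg fun i _ => hp i
  have hN0 : 0 ≤ N := add_nonneg (add_nonneg (he 0) (he m)) hpsum
  have hpN : ∀ i < m, p i ≤ N := fun i hi => by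
    have := Finset.single_le_sum (fun i _ => hp i) (Finset.mem_range.2 hi)
    linarith [he 0, he m]
  have hs2 : ∀ i < m, s i ^ 2 ≤ 2 * ((e i + N) * (e (i + 1) + N)) := fun i hi => by
    have := h1 i hi
    have hq : p i ^ 2 ≤ N ^ 2 := pow_le_pow_left₀ (hp i) (hpN i hi) 2
    nlinarith [mul_nonneg (he i) hN0, mul_nonneg (he (i + 1)) hN0, sq_nonneg N]
  have hrec : ∀ i, i + 2 ≤ m → (e (i + 1) + N) ^ 2 ≤ 16 * ((e i + N) * (e (i + 2) + N)) := by
    intro i hi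
    have ha : 0 ≤ e i + N := add_nonneg (he _) hN0
    have hc : 0 ≤ e (i + 2) + N := add_nonneg (he _) hN0
    have hb : 0 ≤ e (i + 1) + N := add_nonneg (he _) hN0
    obtain ⟨g, hg0, hg⟩ : ∃ g : ℝ, 0 ≤ g ∧ g ^ 2 = (e i + N) * (e (i + 2) + N) :=
      ⟨√((e i + N) * (e (i + 2) + N)), Real.sqrt_nonneg _, Real.sq_sqrt (mul_nonneg ha hc)⟩
    have hss : s i * s (i + 1) ≤ 2 * ((e (i + 1) + N) * g) := by
      refine le_of_sq_le_sq ?_ (by positivity)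
      calc (s i * s (i + 1)) ^ 2 = s i ^ 2 * s (i + 1) ^ 2 := by ring
        _ ≤ (2 * ((e i + N) * (e (i + 1) + N))) * (2 * ((e (i + 1) + N) * (e (i + 2) + N))) := by
          gcongr
          · exact hs2 i (by omega)
          · exact hs2 (i + 1) (by omega)
        _ = 4 * (e (i + 1) + N) ^ 2 * ((e i + N) * (e (i + 2) + N)) := by ring
        _ = (2 * ((e (i + 1) + N) * g)) ^ 2 := by rw [← hg]; ring
    have hNg : N ≤ g := by
      refine le_of_sq_le_sq ?_ hg0
      rw [hg]
      nlinarith [mul_nonneg (he i) (he (i + 2)), mul_nonneg (he i) hN0,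
        mul_nonneg (he (i + 2)) hN0]
    have hpp : p i * p (i + 1) ≤ N * N :=
      mul_le_mul (hpN i (by omega)) (hpN (i + 1) (by omega)) (hp _) hN0
    have h3 : e (i + 1) ^ 2 ≤ 2 * (e (i + 1) + N) * g + g ^ 2 := by
      have := h2 i hi
      nlinarith [mul_nonneg (he i) hN0, mul_nonneg (he (i + 2)) hN0]
    -- With `N ≤ g` the previous bound reads `e² ≤ 2 e g + 3 g²`, that is `(e - 3g)(e + g) ≤ 0`.
    have h4 : e (i + 1) ≤ 3 * g := by
      by_contra hlt
      rw [not_le] at hlt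
      nlinarith [he (i + 1), mul_le_mul_of_nonneg_right hNg hg0]
    rw [← hg]
    have h5 : e (i + 1) + N ≤ 4 * g := by linarith
    calc (e (i + 1) + N) ^ 2 ≤ (4 * g) ^ 2 := pow_le_pow_left₀ hb h5 2
      _ = 16 * g ^ 2 := by ring
  have hbound : ∀ i ≤ m, e i + N ≤ 8 ^ m ^ 2 * (2 * N) := fun i hi =>
    le_of_sq_le_mul (a := fun i => e i + N) (fun j => add_nonneg (he j) hN0) hrec
      (by have := he m; linarith) (by have := he 0; linarith) hi
  refine le_of_sq_le_sq ?_ (by positivity)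
  calc s j ^ 2 ≤ 2 * ((e j + N) * (e (j + 1) + N)) := hs2 j hj
    _ ≤ 2 * ((8 ^ m ^ 2 * (2 * N)) * (8 ^ m ^ 2 * (2 * N))) := by
      have := he (j + 1)
      gcongr
      · exact hbound j hj.le
      · exact hbound (j + 1) hj
    _ ≤ (4 * 8 ^ m ^ 2 * N) ^ 2 := by
      nlinarith [sq_nonneg ((8 : ℝ) ^ m ^ 2 * N)]

end Sequences

/-! ### The energy estimate in a real Hilbert space. -/

section Energy

variable {E : Type*} [NormedAddCommGroup E] [InnerProductSpace ℝ E]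

open scoped RealInnerProductSpace

theorem abs_integral_inner_le {α : Type*} [MeasurableSpace α] {μ : Measure α} {u v : α → E}
    (hu : MemLp u 2 μ) (hv : MemLp v 2 μ) :
    |∫ t, ⟪u t, v t⟫ ∂μ| ≤ √(∫ t, ‖u t‖ ^ 2 ∂μ) * √(∫ t, ‖v t‖ ^ 2 ∂μ) := by
  have h1 : ∫ t, ‖u t‖ * ‖v t‖ ∂μ ≤ √(∫ t, ‖u t‖ ^ 2 ∂μ) * √(∫ t, ‖v t‖ ^ 2 ∂μ) := by
    have := integral_mul_norm_le_Lp_mul_Lq (μ := μ) (f := u) (g := v) (p := 2) (q := 2)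
      (Real.holderConjugate_iff.2 ⟨by norm_num, by norm_num⟩) (by simpa using hu)
      (by simpa using hv)
    simpa [Real.sqrt_eq_rpow] using this
  rw [← Real.norm_eq_abs]
  refine (norm_integral_le_integral_norm _).trans (le_trans ?_ h1)
  refine integral_mono_of_nonneg (ae_of_all _ fun t => norm_nonneg _)
    (hu.norm.integrable_mul hv.norm)
    (ae_of_all _ fun t => ?_)
  exact norm_inner_le_norm _ _

theorem abs_intervalIntegral_inner_le {b t : ℝ} (ht : t ∈ Icc 0 b) {u v : ℝ → E}
    (hu : MemLp u 2 (volume.restrict (Ioc 0 b))) (hv : MemLp v 2 (volume.restrict (Ioc 0 b))) :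
    |∫ s in 0..t, ⟪u s, v s⟫| ≤
      √(∫ s in Ioc 0 b, ‖u s‖ ^ 2) * √(∫ s in Ioc 0 b, ‖v s‖ ^ 2) := by
  have hsub : Ioc 0 t ⊆ Ioc 0 b := Ioc_subset_Ioc_right ht.2
  have hle : volume.restrict (Ioc 0 t) ≤ volume.restrict (Ioc 0 b) :=
    Measure.restrict_mono hsub le_rfl
  have hmono : ∀ {w : ℝ → E}, MemLp w 2 (volume.restrict (Ioc 0 b)) →
      ∫ s in Ioc 0 t, ‖w s‖ ^ 2 ≤ ∫ s in Ioc 0 b, ‖w s‖ ^ 2 := fun hw =>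
    setIntegral_mono_set hw.integrable_norm_pow' (ae_of_all _ fun s => by positivity)
      hsub.eventuallyLE
  rw [intervalIntegral.integral_of_le ht.1]
  refine (abs_integral_inner_le (hu.mono_measure hle) (hv.mono_measure hle)).trans ?_
  exact mul_le_mul (Real.sqrt_le_sqrt (hmono hu)) (Real.sqrt_le_sqrt (hmono hv))
    (Real.sqrt_nonneg _) (Real.sqrt_nonneg _)

variable {B : E →L[ℝ] E} (hB : ∀ x y, ⟪B x, y⟫ = ⟪x, B y⟫)
include hB

theorem inner_pow_shift (i k : ℕ) (x y : E) :
    ⟪(B ^ (i + 1)) x, (B ^ k) y⟫ = ⟪(B ^ i) x, (B ^ (k + 1)) y⟫ := by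
  rw [pow_succ', pow_succ', mul_apply_eq_comp, mul_apply_eq_comp, hB]

variable [CompleteSpace E] {b : ℝ} (hb : 0 ≤ b) {m : ℕ} {h : ℕ → ℝ → E}
  (hL2 : ∀ j ≤ m, MemLp (h j) 2 (volume.restrict (Ioc 0 b)))
  (hprim : ∀ j < m, ∀ t ∈ Icc 0 b, h j t = h j 0 + ∫ s in 0..t, h (j + 1) s)
include hb hL2 hprim

omit hB in
theorem energy_product_rule {j k : ℕ} (hj : j < m) (hk : k < m) (p q : ℕ) :
    (∫ t in 0..b, ⟪(B ^ p) (h j t), (B ^ q) (h (k + 1) t)⟫) +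
      ∫ t in 0..b, ⟪(B ^ p) (h (j + 1) t), (B ^ q) (h k t)⟫ =
      ⟪(B ^ p) (h j b), (B ^ q) (h k b)⟫ - ⟪(B ^ p) (h j 0), (B ^ q) (h k 0)⟫ := by
  have hint : ∀ i ≤ m, ∀ t ∈ Icc 0 b, IntervalIntegrable (h i) volume 0 t := fun i hi t ht =>
    (intervalIntegrable_iff_integrableOn_Ioc_of_le ht.1).2
      (IntegrableOn.mono_set (t := Ioc 0 b) ((hL2 i hi).integrable one_le_two)
        (Ioc_subset_Ioc_right ht.2))
  have hpr : ∀ i < m, ∀ n : ℕ, ∀ t ∈ Icc 0 b,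
      (B ^ n) (h i t) = (B ^ n) (h i 0) + ∫ s in 0..t, (B ^ n) (h (i + 1) s) := by
    intro i hi n t ht
    rw [ContinuousLinearMap.intervalIntegral_comp_comm _ (hint _ hi t ht), ← map_add,
      ← hprim i hi t ht]
  have hi' : ∀ i ≤ m, ∀ n : ℕ, IntervalIntegrable (fun t => (B ^ n) (h i t)) volume 0 b := by
    intro i hi n
    rw [intervalIntegrable_iff_integrableOn_Ioc_of_le hb]
    exact (B ^ n).integrable_comp ((hL2 i hi).integrable one_le_two)
  exact integral_product_rule (innerSL ℝ) hb (hi' (j + 1) hj p) (hi' (k + 1) hk q)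
    (hpr j hj p) (hpr k hk q)

/-- The energy estimate. -/
theorem norm_le_energy {j : ℕ} (hj : j < m) :
    ‖(B ^ (2 * j + 1)) (h j b)‖ ≤ 4 * 8 ^ m ^ 2 *
      (√(∫ t in Ioc 0 b, ‖h 0 t‖ ^ 2) + √(∫ t in Ioc 0 b, ‖(B ^ (2 * m)) (h m t)‖ ^ 2) +
        ∑ i ∈ Finset.range m, ‖(B ^ (2 * i + 1)) (h i 0)‖) := by
  have hBL2 : ∀ j ≤ m, ∀ n : ℕ,
      MemLp (fun t => (B ^ n) (h j t)) 2 (volume.restrict (Ioc 0 b)) := fun j hj n =>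
    (B ^ n).comp_memLp' (hL2 j hj)
  have hbb : b ∈ Icc 0 b := ⟨hb, le_rfl⟩
  have := le_of_energy_inequalities (m := m)
    (e := fun j => √(∫ t in Ioc 0 b, ‖(B ^ (2 * j)) (h j t)‖ ^ 2))
    (s := fun j => ‖(B ^ (2 * j + 1)) (h j b)‖) (p := fun j => ‖(B ^ (2 * j + 1)) (h j 0)‖)
    (fun _ => Real.sqrt_nonneg _) (fun _ => norm_nonneg _)
    (fun j hj => ?_) (fun i hi => ?_) hj
  · simpa using this
  -- Integrated derivative of `‖B^{2j+1} h_j‖²`. Shifting one factor `B` across the inner product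
  -- makes both integrals pairings of the functions defining `e j` and `e (j + 1)`.
  · have h1 := energy_product_rule (B := B) hb hL2 hprim hj hj (2 * j + 1) (2 * j + 1)
    have h2 := abs_intervalIntegral_inner_le hbb (hBL2 j hj.le (2 * j))
      (hBL2 (j + 1) hj (2 * (j + 1)))
    have h3 : ∀ t, ⟪(B ^ (2 * j + 1)) (h j t), (B ^ (2 * j + 1)) (h (j + 1) t)⟫ =
        ⟪(B ^ (2 * j)) (h j t), (B ^ (2 * (j + 1))) (h (j + 1) t)⟫ := fun t =>
      inner_pow_shift hB _ _ _ _
    have h4 : ∀ t, ⟪(B ^ (2 * j + 1)) (h (j + 1) t), (B ^ (2 * j + 1)) (h j t)⟫ =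
        ⟪(B ^ (2 * j)) (h j t), (B ^ (2 * (j + 1))) (h (j + 1) t)⟫ := fun t => by
      rw [real_inner_comm, h3]
    simp only [h3, h4, real_inner_self_eq_norm_sq] at h1
    have := abs_le.1 h2
    linarith
  -- The product rule for `h_i` and `h_{i+1}`: after the shift one integral is exactly `e (i + 1) ^
  -- 2` and the other is bounded by `e i * e (i + 2)`.
  · have h1 := energy_product_rule (B := B) hb hL2 hprim (j := i) (k := i + 1) (by omega) (by omega)
      (2 * i + 1) (2 * (i + 1) + 1)
    have h2 := abs_intervalIntegral_inner_le hbb (hBL2 i (by omega) (2 * i))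
      (hBL2 (i + 2) hi (2 * (i + 2)))
    have h3 : ∀ t, ⟪(B ^ (2 * i + 1)) (h i t), (B ^ (2 * (i + 1) + 1)) (h (i + 1 + 1) t)⟫ =
        ⟪(B ^ (2 * i)) (h i t), (B ^ (2 * (i + 2))) (h (i + 2) t)⟫ := fun t =>
      inner_pow_shift hB _ _ _ _
    have h4 : ∀ t, ⟪(B ^ (2 * i + 1)) (h (i + 1) t), (B ^ (2 * (i + 1) + 1)) (h (i + 1) t)⟫ =
        ‖(B ^ (2 * (i + 1))) (h (i + 1) t)‖ ^ 2 := fun t => by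
      rw [← real_inner_self_eq_norm_sq]
      exact (inner_pow_shift hB _ _ _ _).symm
    simp only [h3, h4] at h1
    rw [intervalIntegral.integral_of_le hb (f := fun t => ‖(B ^ (2 * (i + 1))) (h (i + 1) t)‖ ^ 2)]
      at h1
    rw [Real.sq_sqrt (integral_nonneg fun t => by positivity)]
    have h5 := abs_le.1 h2
    have h6 := abs_le.1 (abs_real_inner_le_norm ((B ^ (2 * i + 1)) (h i b))
      ((B ^ (2 * (i + 1) + 1)) (h (i + 1) b)))
    have h7 := abs_le.1 (abs_real_inner_le_norm ((B ^ (2 * i + 1)) (h i 0))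
      ((B ^ (2 * (i + 1) + 1)) (h (i + 1) 0)))
    linarith

end Energy

/-! ### The energy estimate for regularised derivatives. -/

section Smoothing

variable {𝕜 H V : Type*} [RCLike 𝕜]
  [NormedAddCommGroup H] [InnerProductSpace 𝕜 H] [NormedSpace ℝ H] [CompleteSpace H]
  [NormedAddCommGroup V] [InnerProductSpace 𝕜 V] [CompleteSpace V]

variable (𝕜) in
/-- The real inner product on `H`, over the given real normed space structure. -/
abbrev realInnerProductSpace (H : Type*) [NormedAddCommGroup H] [InnerProductSpace 𝕜 H]
    [NormedSpace ℝ H] : InnerProductSpace ℝ H where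
  inner x y := RCLike.re (inner 𝕜 x y)
  norm_sq_eq_re_inner x := norm_sq_eq_re_inner (𝕜 := 𝕜) x
  conj_inner_symm x y := inner_re_symm y x
  add_left x y z := by rw [inner_add_left, map_add]
  smul_left x y r := by
    rw [← ofReal_smul_eq (𝕜 := 𝕜), inner_smul_left, RCLike.conj_ofReal, RCLike.re_ofReal_mul]
    rfl

/-- The constant of the energy estimate for squares. -/
def energyConst (m : ℕ) : ℝ := (4 * 8 ^ m ^ 2) ^ 2 * (3 * m)

/-- Squared, the right side consists of integrals to which dominated convergence applies directly.
The factor `3 m` comes from squaring a sum of three terms, one of which is itself a sum of `m`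
terms. -/
theorem norm_sq_le_energy {B : H →L[𝕜] H} (hB : B.IsSymmetric) {b : ℝ} (hb : 0 ≤ b) {m : ℕ}
    {h : ℕ → ℝ → H} (hL2 : ∀ j ≤ m, MemLp (h j) 2 (volume.restrict (Ioc 0 b)))
    (hprim : ∀ j < m, ∀ t ∈ Icc 0 b, h j t = h j 0 + ∫ s in 0..t, h (j + 1) s)
    {j : ℕ} (hj : j < m) :
    ‖(B ^ (2 * j + 1)) (h j b)‖ ^ 2 ≤ energyConst m *
      ((∫ t in Ioc 0 b, ‖h 0 t‖ ^ 2) + (∫ t in Ioc 0 b, ‖(B ^ (2 * m)) (h m t)‖ ^ 2) +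
        ∑ i ∈ Finset.range m, ‖(B ^ (2 * i + 1)) (h i 0)‖ ^ 2) := by
  let _ : InnerProductSpace ℝ H := realInnerProductSpace 𝕜 H
  have hpow : ∀ n : ℕ, ∀ x : H, ((B.restrictScalars ℝ) ^ n) x = (B ^ n) x := by
    intro n
    induction n with
    | zero => simp
    | succ n ih =>
      intro x
      rw [pow_succ', pow_succ', mul_apply_eq_comp, mul_apply_eq_comp, ih]
      rfl
  have key := norm_le_energy (B := B.restrictScalars ℝ)
    (fun x y => congrArg RCLike.re (hB x y)) hb hL2 hprim hj
  simp only [hpow] at key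
  set I0 := ∫ t in Ioc 0 b, ‖h 0 t‖ ^ 2
  set I1 := ∫ t in Ioc 0 b, ‖(B ^ (2 * m)) (h m t)‖ ^ 2
  set S := ∑ i ∈ Finset.range m, ‖(B ^ (2 * i + 1)) (h i 0)‖
  have h0 : √I0 ^ 2 = I0 := Real.sq_sqrt (integral_nonneg fun t => by positivity)
  have h1 : √I1 ^ 2 = I1 := Real.sq_sqrt (integral_nonneg fun t => by positivity)
  have hS : S ^ 2 ≤ m * ∑ i ∈ Finset.range m, ‖(B ^ (2 * i + 1)) (h i 0)‖ ^ 2 := by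
    have := sq_sum_le_card_mul_sum_sq (s := Finset.range m)
      (f := fun i => ‖(B ^ (2 * i + 1)) (h i 0)‖)
    rwa [Finset.card_range] at this
  have hm : (1 : ℝ) ≤ m := by exact_mod_cast Nat.one_le_of_lt hj
  have hI0 : 0 ≤ I0 := by rw [← h0]; positivity
  have hI1 : 0 ≤ I1 := by rw [← h1]; positivity
  calc ‖(B ^ (2 * j + 1)) (h j b)‖ ^ 2 ≤ (4 * 8 ^ m ^ 2 * (√I0 + √I1 + S)) ^ 2 :=
        pow_le_pow_left₀ (norm_nonneg _) key 2
    _ = (4 * 8 ^ m ^ 2) ^ 2 * (√I0 + √I1 + S) ^ 2 := by ring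
    _ ≤ (4 * 8 ^ m ^ 2) ^ 2 * (3 * (I0 + I1 + S ^ 2)) := by
      gcongr
      have : (√I0 + √I1 + S) ^ 2 ≤ 3 * (√I0 ^ 2 + √I1 ^ 2 + S ^ 2) := by
        nlinarith [sq_nonneg (√I0 - √I1), sq_nonneg (√I0 - S), sq_nonneg (√I1 - S)]
      rwa [h0, h1] at this
    _ ≤ (4 * 8 ^ m ^ 2) ^ 2 * (3 * (m * (I0 + I1 +
          ∑ i ∈ Finset.range m, ‖(B ^ (2 * i + 1)) (h i 0)‖ ^ 2))) := by
      gcongr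
      nlinarith
    _ = _ := by
      rw [energyConst]
      ring

omit [NormedSpace ℝ H] [CompleteSpace H] in
theorem pow_apply_comm_apply {B Q : H →L[𝕜] H} (hc : Commute B Q) (a c : ℕ) (x : H) :
    (B ^ a) (Q ((B ^ c) x)) = (B ^ (a + c)) (Q x) := by
  have h := (hc.pow_left c).eq
  rw [pow_add, mul_apply_eq_comp]
  exact congrArg (fun A : H →L[𝕜] H => (B ^ a) (A x)) h.symm

theorem restrict_Ioc_le {τ : EReal} {b : ℝ} (hb : b ∈ closedI τ) :
    volume.restrict (Ioc 0 b) ≤ volume.restrict (openI τ) := by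
  rw [← Measure.restrict_congr_set Ioo_ae_eq_Ioc]
  exact Measure.restrict_mono (Ioo_subset_openI hb) le_rfl

theorem intervalIntegrable_of_memLp {E : Type*} [NormedAddCommGroup E] {τ : EReal} {F : ℝ → E}
    (hF : MemLp F 2 (volume.restrict (openI τ))) {b : ℝ} (hb : b ∈ closedI τ) :
    IntervalIntegrable F volume 0 b :=
  (intervalIntegrable_iff_integrableOn_Ioc_of_le hb.1).2
    ((hF.mono_measure (restrict_Ioc_le hb)).integrable one_le_two)

/-- The energy estimate for the derivatives of `u = B ^ (2m) v`, smoothed by an operator `Q`. -/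
theorem norm_sq_smoothed_le {B Q : H →L[𝕜] H} (hB : B.IsSymmetric) (hc : Commute B Q) {m : ℕ}
    {τ : EReal} {v F : ℝ → H} {D : ℕ → ℝ → H} {y : ℕ → H}
    (hv : MemLp v 2 (volume.restrict (openI τ))) (hF : MemLp F 2 (volume.restrict (openI τ)))
    (hD0 : (fun t => (B ^ (2 * m)) (v t)) =ᵐ[volume.restrict (openI τ)] D 0) (hDm : D m = F)
    (hD : ∀ j < m, ContinuousOn (D j) (closedI τ) ∧
        ∀ t ∈ closedI τ, D j t = D j 0 + ∫ s in 0..t, D (j + 1) s)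
    (hy : ∀ i < m, D i 0 = (B ^ (2 * m - 2 * i - 1)) (y i))
    {b : ℝ} (hb : b ∈ closedI τ) {j : ℕ} (hj : j < m) :
    ‖(B ^ (2 * m + 2 * j + 1)) (Q (D j b))‖ ^ 2 ≤ energyConst m *
      ((∫ t in openI τ, ‖(B ^ (4 * m)) (Q (v t))‖ ^ 2) +
        (∫ t in openI τ, ‖(B ^ (4 * m)) (Q (F t))‖ ^ 2) +
        ∑ i ∈ Finset.range m, ‖(B ^ (4 * m)) (Q (y i))‖ ^ 2) := by
  -- For `Q` close to `T⁻¹ = B^{-4m}` the operator `A` is a bounded substitute for `Λ = B^{-2m}`,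
  -- and `P` is close to the identity.
  set A : H →L[𝕜] H := B ^ (2 * m) * Q with hA
  set P : H →L[𝕜] H := B ^ (4 * m) * Q with hP
  have hDL2 : ∀ j ≤ m, MemLp (D j) 2 (volume.restrict (Ioc 0 b)) := by
    intro j hj
    rcases hj.lt_or_eq with hj | rfl
    · have hcont := (hD j hj).1.mono (Icc_subset_closedI hb)
      obtain ⟨C, hC⟩ := isCompact_Icc.exists_bound_of_continuousOn hcont
      refine MemLp.of_bound ((hcont.mono Ioc_subset_Icc_self).aestronglyMeasurable
        measurableSet_Ioc) C ?_
      filter_upwards [ae_restrict_mem measurableSet_Ioc] with t ht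
      exact hC t (Ioc_subset_Icc_self ht)
    · rw [hDm]
      exact hF.mono_measure (restrict_Ioc_le hb)
  have hint : ∀ j ≤ m, ∀ t ∈ Icc 0 b, IntervalIntegrable (D j) volume 0 t := fun i hi t ht =>
    (intervalIntegrable_iff_integrableOn_Ioc_of_le ht.1).2
      (IntegrableOn.mono_set (t := Ioc 0 b) ((hDL2 i hi).integrable one_le_two)
        (Ioc_subset_Ioc_right ht.2))
  have key := norm_sq_le_energy hB hb.1 (h := fun j t => A (D j t))
    (fun j hj => A.comp_memLp' (hDL2 j hj)) (fun j hj t ht => by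
      have h1 := (A.restrictScalars ℝ).intervalIntegral_comp_comm (hint (j + 1) hj t ht)
      have h2 := congrArg A ((hD j hj).2 t (Icc_subset_closedI hb ht))
      rw [map_add] at h2
      exact h2.trans (congrArg (A (D j 0) + ·) h1.symm)) hj
  have e0 : ∀ x, (B ^ (2 * j + 1)) (A x) = (B ^ (2 * m + 2 * j + 1)) (Q x) := fun x => by
    rw [hA, mul_apply_eq_comp, ← mul_apply_eq_comp, ← pow_add]
    congr 2
    ring
  have e1 : ∀ x, A ((B ^ (2 * m)) x) = P x := fun x => by
    rw [hA, mul_apply_eq_comp, pow_apply_comm_apply hc, hP, mul_apply_eq_comp]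
    congr 2
    ring
  have e2 : ∀ x, (B ^ (2 * m)) (A x) = P x := fun x => by
    rw [hA, mul_apply_eq_comp, ← mul_apply_eq_comp, ← pow_add, hP, mul_apply_eq_comp]
    congr 2
    ring
  have e3 : ∀ i < m, (B ^ (2 * i + 1)) (A (D i 0)) = P (y i) := fun i hi => by
    rw [hy i hi, hA, mul_apply_eq_comp, pow_apply_comm_apply hc, ← mul_apply_eq_comp, ← pow_add, hP,
      mul_apply_eq_comp]
    congr 2
    omega
  have hae : ∀ᵐ t ∂(volume.restrict (Ioc 0 b)), A (D 0 t) = P (v t) := by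
    filter_upwards [(Measure.absolutelyContinuous_of_le (restrict_Ioc_le hb)).ae_eq hD0] with t ht
    rw [← ht, e1]
  have hmono : ∀ {w : ℝ → H}, MemLp w 2 (volume.restrict (openI τ)) →
      ∫ t in Ioc 0 b, ‖P (w t)‖ ^ 2 ≤ ∫ t in openI τ, ‖P (w t)‖ ^ 2 := fun hw =>
    integral_mono_measure (restrict_Ioc_le hb) (ae_of_all _ fun t => by positivity)
      ((memLp_two_iff_integrable_sq_norm (P.comp_memLp' hw).1).1 (P.comp_memLp' hw))
  have hC : 0 ≤ energyConst m := by
    rw [energyConst]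
    positivity
  rw [e0] at key
  refine key.trans (mul_le_mul_of_nonneg_left (add_le_add (add_le_add ?_ ?_) ?_) hC)
  · rw [integral_congr_ae (g := fun t => ‖P (v t)‖ ^ 2) (by
      filter_upwards [hae] with t ht
      rw [ht])]
    exact hmono hv
  · simp only [e2, hDm]
    exact hmono hF
  · refine Finset.sum_le_sum fun i hi => ?_
    rw [e3 i (Finset.mem_range.1 hi)]
    rfl

omit [NormedSpace ℝ H] in
open Filter Topology in
theorem exists_limit_of_sq_le {S : Set ℝ} {z : ℕ → ℝ → H} {δ : ℕ → ℝ}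
    (hz : ∀ n, ContinuousOn (z n) S) (hδ : Tendsto δ atTop (𝓝 0))
    (h : ∀ n k, ∀ t ∈ S, ‖z n t - z k t‖ ^ 2 ≤ δ n + δ k) :
    ∃ w : ℝ → H, ContinuousOn w S ∧ ∀ t ∈ S, Tendsto (fun n => z n t) atTop (𝓝 (w t)) := by
  have hc : UniformCauchySeqOn z atTop S := by
    rw [Metric.uniformCauchySeqOn_iff]
    intro ε hε
    obtain ⟨N, hN⟩ := eventually_atTop.1
      (hδ.eventually (gt_mem_nhds (show (0 : ℝ) < ε ^ 2 / 2 by positivity)))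
    refine ⟨N, fun n hn k hk t ht => ?_⟩
    rw [dist_eq_norm]
    refine lt_of_pow_lt_pow_left₀ 2 hε.le ?_
    linarith [h n k t ht, hN n hn, hN k hk]
  have hlim : ∀ t, ∃ w, t ∈ S → Tendsto (fun n => z n t) atTop (𝓝 w) := fun t => by
    by_cases ht : t ∈ S
    · obtain ⟨w, hw⟩ := cauchySeq_tendsto_of_complete (hc.cauchySeq ht)
      exact ⟨w, fun _ => hw⟩
    · exact ⟨0, fun h => absurd h ht⟩
  choose w hw using hlim
  exact ⟨w, (hc.tendstoUniformlyOn_of_tendsto fun t ht => hw t ht).continuousOn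
    (Eventually.of_forall hz).frequently, fun t ht => hw t ht⟩

omit [NormedSpace ℝ H] [CompleteSpace H] in
open Filter Topology in
theorem tendsto_integral_norm_sq_sub {α : Type*} [MeasurableSpace α] {μ : Measure α} {v : α → H}
    (hv : MemLp v 2 μ) {P : ℕ → H →L[𝕜] H} (hP : ∀ n, ‖P n‖ ≤ 1)
    (hlim : ∀ x, Tendsto (fun n => P n x) atTop (𝓝 x)) :
    Tendsto (fun n => ∫ t, ‖P n (v t) - v t‖ ^ 2 ∂μ) atTop (𝓝 0) := by
  have h0 : (0 : ℝ) = ∫ _ : α, (0 : ℝ) ∂μ := by simp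
  rw [h0]
  refine tendsto_integral_of_dominated_convergence (fun t => 4 * ‖v t‖ ^ 2) (fun n => ?_)
    (((memLp_two_iff_integrable_sq_norm hv.1).1 hv).const_mul 4) (fun n => ae_of_all _ fun t => ?_)
    (ae_of_all _ fun t => ?_)
  · exact (((P n).comp_memLp' hv).sub hv).1.norm.pow 2
  · rw [Real.norm_of_nonneg (by positivity)]
    have h1 : ‖P n (v t)‖ ≤ ‖v t‖ := by simpa using (P n).le_of_opNorm_le (hP n) (v t)
    have h2 : ‖P n (v t) - v t‖ ≤ 2 * ‖v t‖ := by linarith [norm_sub_le (P n (v t)) (v t)]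
    calc ‖P n (v t) - v t‖ ^ 2 ≤ (2 * ‖v t‖) ^ 2 := pow_le_pow_left₀ (norm_nonneg _) h2 2
      _ = 4 * ‖v t‖ ^ 2 := by ring
  · have := ((hlim (v t)).sub_const (v t)).norm.pow 2
    simpa using this

end Smoothing

/-! ### Removing the regularisation. -/

section Traces

variable {𝕜 H V : Type*} [RCLike 𝕜]
  [NormedAddCommGroup H] [InnerProductSpace 𝕜 H] [NormedSpace ℝ H] [CompleteSpace H]
  [NormedAddCommGroup V] [InnerProductSpace 𝕜 V] [CompleteSpace V]

omit [NormedSpace ℝ H] [CompleteSpace H] in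
theorem integral_norm_sq_apply_le {α : Type*} [MeasurableSpace α] {μ : Measure α} {v : α → H}
    (hv : MemLp v 2 μ) {P : H →L[𝕜] H} (hP : ‖P‖ ≤ 1) :
    ∫ t, ‖P (v t)‖ ^ 2 ∂μ ≤ ∫ t, ‖v t‖ ^ 2 ∂μ := by
  refine integral_mono
    ((memLp_two_iff_integrable_sq_norm (P.comp_memLp' hv).1).1 (P.comp_memLp' hv))
    ((memLp_two_iff_integrable_sq_norm hv.1).1 hv) fun t => ?_
  exact pow_le_pow_left₀ (norm_nonneg _) (by simpa using P.le_of_opNorm_le hP (v t)) 2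

omit [NormedSpace ℝ H] [CompleteSpace H] in
theorem norm_sub_apply_sq_le (P P' : H →L[𝕜] H) (x : H) :
    ‖(P - P') x‖ ^ 2 ≤ 2 * ‖P x - x‖ ^ 2 + 2 * ‖P' x - x‖ ^ 2 := by
  have h : (P - P') x = (P x - x) - (P' x - x) := by
    rw [sub_apply]
    abel
  have h1 := norm_sub_le (P x - x) (P' x - x)
  rw [← h] at h1
  have h2 := pow_le_pow_left₀ (norm_nonneg _) h1 2
  nlinarith [sq_nonneg (‖P x - x‖ - ‖P' x - x‖)]

omit [NormedSpace ℝ H] [CompleteSpace H] in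
theorem integral_norm_sub_apply_sq_le {α : Type*} [MeasurableSpace α] {μ : Measure α} {v : α → H}
    (hv : MemLp v 2 μ) (P P' : H →L[𝕜] H) :
    ∫ t, ‖(P - P') (v t)‖ ^ 2 ∂μ ≤
      2 * (∫ t, ‖P (v t) - v t‖ ^ 2 ∂μ) + 2 * ∫ t, ‖P' (v t) - v t‖ ^ 2 ∂μ := by
  have hi : ∀ R : H →L[𝕜] H, Integrable (fun t => 2 * ‖R (v t) - v t‖ ^ 2) μ := fun R =>
    have h := (R.comp_memLp' hv).sub hv
    ((memLp_two_iff_integrable_sq_norm h.1).1 h).const_mul 2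
  have hl := (P - P').comp_memLp' hv
  rw [← integral_const_mul, ← integral_const_mul, ← integral_add (hi P) (hi P')]
  exact integral_mono ((memLp_two_iff_integrable_sq_norm hl.1).1 hl) ((hi P).add (hi P'))
    fun t => norm_sub_apply_sq_le P P' (v t)

open Filter Topology in
/-- The derivatives of `u = B ^ (2m) v` are continuous with values in the ranges of the
appropriate powers of `B`. -/
theorem exists_continuous_preimage {B : H →L[𝕜] H} (hB : B.IsSymmetric) {m : ℕ}
    {Q : ℕ → H →L[𝕜] H} (hc : ∀ n, Commute B (Q n)) (hP : ∀ n, ‖B ^ (4 * m) * Q n‖ ≤ 1)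
    (hlim : ∀ x, Tendsto (fun n => (B ^ (4 * m) * Q n) x) atTop (𝓝 x))
    {τ : EReal} {v F : ℝ → H} {D : ℕ → ℝ → H} {y : ℕ → H}
    (hv : MemLp v 2 (volume.restrict (openI τ))) (hF : MemLp F 2 (volume.restrict (openI τ)))
    (hD0 : (fun t => (B ^ (2 * m)) (v t)) =ᵐ[volume.restrict (openI τ)] D 0) (hDm : D m = F)
    (hD : ∀ j < m, ContinuousOn (D j) (closedI τ) ∧
        ∀ t ∈ closedI τ, D j t = D j 0 + ∫ s in 0..t, D (j + 1) s)
    (hy : ∀ i < m, D i 0 = (B ^ (2 * m - 2 * i - 1)) (y i)) {j : ℕ} (hj : j < m) :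
    ∃ w : ℝ → H, ContinuousOn w (closedI τ) ∧ ∀ t ∈ closedI τ,
      (B ^ (2 * m - 2 * j - 1)) (w t) = D j t ∧
      ‖w t‖ ^ 2 ≤ energyConst m * ((∫ t in openI τ, ‖v t‖ ^ 2) + (∫ t in openI τ, ‖F t‖ ^ 2) +
        ∑ i ∈ Finset.range m, ‖y i‖ ^ 2) := by
  have hK : 0 ≤ energyConst m := by
    rw [energyConst]
    positivity
  set P : ℕ → H →L[𝕜] H := fun n => B ^ (4 * m) * Q n with hPdef
  set z : ℕ → ℝ → H := fun n t => (B ^ (2 * m + 2 * j + 1)) (Q n (D j t)) with hz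
  set δ : ℕ → ℝ := fun n => energyConst m * (2 * ((∫ t in openI τ, ‖P n (v t) - v t‖ ^ 2) +
    (∫ t in openI τ, ‖P n (F t) - F t‖ ^ 2) +
    ∑ i ∈ Finset.range m, ‖P n (y i) - y i‖ ^ 2)) with hδ
  have hδ0 : Tendsto δ atTop (𝓝 0) := by
    have h1 := tendsto_integral_norm_sq_sub hv hP hlim
    have h2 := tendsto_integral_norm_sq_sub hF hP hlim
    have h3 : Tendsto (fun n => ∑ i ∈ Finset.range m, ‖P n (y i) - y i‖ ^ 2) atTop (𝓝 0) := by
      rw [← Finset.sum_const_zero (s := Finset.range m)]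
      refine tendsto_finsetSum _ fun i _ => ?_
      have := ((hlim (y i)).sub_const (y i)).norm.pow 2
      rwa [sub_self, norm_zero, zero_pow two_ne_zero] at this
    have := (((h1.add h2).add h3).const_mul 2).const_mul (energyConst m)
    simp only [add_zero, mul_zero] at this
    exact this
  obtain ⟨w, hwc, hw⟩ := exists_limit_of_sq_le (S := closedI τ) (z := z) (δ := δ)
    (fun n => ((B ^ (2 * m + 2 * j + 1)).continuous.comp (Q n).continuous).comp_continuousOn
      (hD j hj).1) hδ0 fun n k t ht => by
    -- The estimate allows any `Q` commuting with `B`; the choice `Q n - Q k` makes `z n` uniformly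
    -- Cauchy on `closedI τ`.
    have h1 := norm_sq_smoothed_le hB ((hc n).sub_right (hc k)) hv hF hD0 hDm hD hy ht hj
    have h2 : ∀ x, (B ^ (4 * m)) ((Q n - Q k) x) = (P n - P k) x := fun x => by
      simp [hPdef, map_sub]
    have h3 : (B ^ (2 * m + 2 * j + 1)) ((Q n - Q k) (D j t)) = z n t - z k t := by
      rw [sub_apply, map_sub]
    rw [h3] at h1
    simp only [h2] at h1
    refine h1.trans ?_
    rw [hδ, ← mul_add]
    refine mul_le_mul_of_nonneg_left ?_ hK
    have h4 := integral_norm_sub_apply_sq_le hv (P n) (P k)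
    have h5 := integral_norm_sub_apply_sq_le hF (P n) (P k)
    have h6 : ∑ i ∈ Finset.range m, ‖(P n - P k) (y i)‖ ^ 2 ≤
        2 * (∑ i ∈ Finset.range m, ‖P n (y i) - y i‖ ^ 2) +
          2 * ∑ i ∈ Finset.range m, ‖P k (y i) - y i‖ ^ 2 := by
      rw [Finset.mul_sum, Finset.mul_sum, ← Finset.sum_add_distrib]
      exact Finset.sum_le_sum fun i _ => norm_sub_apply_sq_le _ _ _
    linarith
  refine ⟨w, hwc, fun t ht => ⟨?_, ?_⟩⟩
  -- The exponents `2m - 2j - 1` and `2m + 2j + 1` add up to `4m`, so `P n (D j t)` appears and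
  -- tends to `D j t`.
  · have h1 : ∀ n, (B ^ (2 * m - 2 * j - 1)) (z n t) = P n (D j t) := fun n => by
      rw [hz, ← mul_apply_eq_comp, ← pow_add, hPdef, mul_apply_eq_comp]
      congr 2
      omega
    refine tendsto_nhds_unique ?_ (hlim (D j t))
    have h2 := ((B ^ (2 * m - 2 * j - 1)).continuous.tendsto _).comp (hw t ht)
    exact h2.congr h1
  · refine le_of_tendsto ((hw t ht).norm.pow 2) (Eventually.of_forall fun n => ?_)
    refine (norm_sq_smoothed_le hB (hc n) hv hF hD0 hDm hD hy ht hj).trans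
      (mul_le_mul_of_nonneg_left (add_le_add (add_le_add ?_ ?_) ?_) hK)
    · exact integral_norm_sq_apply_le hv (hP n)
    · exact integral_norm_sq_apply_le hF (hP n)
    · refine Finset.sum_le_sum fun i _ => pow_le_pow_left₀ (norm_nonneg _) ?_ 2
      exact ((P n).le_of_opNorm_le (hP n) (y i)).trans_eq (one_mul _)

theorem exists_smoothing {T B : H →L[𝕜] H} (hT : T.IsPositive)
    (hd : DenseRange T) {n : ℕ} (hBn : B ^ n = T)
    (hc : ∀ r : ℝ, 0 < r → Commute B (Ring.inverse ((r : 𝕜) • (1 : H →L[𝕜] H) + T))) :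
    ∃ Q : ℕ → H →L[𝕜] H, (∀ k, Commute B (Q k)) ∧ (∀ k, ‖B ^ n * Q k‖ ≤ 1) ∧
      ∀ x, Filter.Tendsto (fun k => (B ^ n * Q k) x) Filter.atTop (nhds x) := by
  have hpos : ∀ k : ℕ, (0 : ℝ) < 1 / (k + 1) := fun k => by positivity
  rw [hBn]
  exact ⟨fun k => Ring.inverse (((1 / (k + 1) : ℝ) : 𝕜) • (1 : H →L[𝕜] H) + T),
    fun k => hc _ (hpos k), fun k => norm_mul_inverse_le hT (hpos k), tendsto_mul_inverse hT hd⟩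

/-- This is the reason for taking a `4m`-th root: all the powers `Λ^{-θ}` needed become integer
powers of `B`. The subtraction on naturals is exact because `j < m`. -/
theorem traceExp_div_two {m : ℕ} {j : ℕ} (hj : j < m) :
    traceExp m j / 2 = ((2 * m - 2 * j - 1 : ℕ) : ℝ) / ((4 * m : ℕ) : ℝ) := by
  have hm : (m : ℝ) ≠ 0 := by
    have : m ≠ 0 := by omega
    exact_mod_cast this
  rw [traceExp, Nat.sub_sub, Nat.cast_sub (by omega)]
  push_cast
  field_simp
  ring

end Traces

end LionsMagenes

end

/-! ### The theorem. -/

open LionsMagenes in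
/-- `D j` is the `j`-th derivative of `f`, as a continuous function `[0, τ] → H`; `a j` is the
initial value `D j 0`, regarded as an element of `[H, V]_{1-(2j+1)/(2m)}`; `g j` is `D j`,
regarded as a function with values in that space. -/
theorem mainTheorem9 {𝕜 H V : Type*} [RCLike 𝕜]
    [NormedAddCommGroup H] [InnerProductSpace 𝕜 H] [NormedSpace ℝ H] [CompleteSpace H]
    [NormedAddCommGroup V] [InnerProductSpace 𝕜 V] [CompleteSpace V]
    (ι : V →L[𝕜] H) (hinj : Function.Injective ι) (hdense : DenseRange ι)
    (m : ℕ) (hm : 1 ≤ m) :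
    ∃ k : ℝ, 0 < k ∧
      ∀ (τ : EReal), 0 < τ → ∀ (f : ℝ → V) (F : ℝ → H), MemZ ι m τ f F →
        ∃ D : Fin m → ℝ → H,
          (∀ j : Fin m, IsContDeriv ι τ f j (D j)) ∧
          ∀ a : (j : Fin m) → interpSpace ι (traceExp m j),
            (∀ j : Fin m, interpToH (a j) = D j 0) →
            ∃ g : (j : Fin m) → ℝ → interpSpace ι (traceExp m j),
              (∀ j : Fin m, ∀ t ∈ closedI τ, interpToH (g j t) = D j t) ∧
              (∀ j : Fin m, ContinuousOn (g j) (closedI τ)) ∧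
              ∀ j : Fin m, ∀ t ∈ closedI τ,
                ‖g j t‖ ≤ k * (normZ τ f F + ∑ i : Fin m, ‖a i‖) := by
  have hT := formInv_isPositive ι
  obtain ⟨B, hB, hBn, hBc, hBp⟩ := exists_root hT (n := 4 * m) (by omega)
  obtain ⟨Q, hQc, hQ1, hQlim⟩ :=
    exists_smoothing hT (denseRange_formInv hinj hdense) hBn hBc
  -- Since `B ^ (2 * m)` plays the role of `Λ⁻¹`, `U` is `Λ` on `V`.
  obtain ⟨U, hU, hUι⟩ := exists_polar hinj (R := B ^ (2 * m))
    (isSymmetric_clm_pow hB _)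
    (by rw [← pow_add, ← hBn]; congr 1; ring)
  have hfrac : ∀ j : Fin m, ∃ c : ℝ, 0 < c ∧
      fracPow (formInv ι) (traceExp m j / 2) = c • B ^ (2 * m - 2 * (j : ℕ) - 1) := fun j => by
    rw [traceExp_div_two j.2]
    exact hBp _ (by omega) (by omega)
  choose c hc0 hc using hfrac
  -- One constant for the passage between `w`, `y` and the graph norms. It involves only `ι` and `m`
  -- and is fixed before `τ` and `f`.
  set κ : ℝ := 1 + ∑ j : Fin m, (‖B ^ (2 * m - 2 * (j : ℕ) - 1)‖ + (c j)⁻¹ + c j) with hκ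
  have hterm : ∀ j : Fin m, ‖B ^ (2 * m - 2 * (j : ℕ) - 1)‖ + (c j)⁻¹ + c j ≤ κ := fun j => by
    have := Finset.single_le_sum (f := fun j : Fin m =>
      ‖B ^ (2 * m - 2 * (j : ℕ) - 1)‖ + (c j)⁻¹ + c j) (fun i _ => by
        have := hc0 i
        positivity) (Finset.mem_univ j)
    linarith
  have hκ1 : 1 ≤ κ := le_add_of_nonneg_right (Finset.sum_nonneg fun i _ => by
    have := hc0 i
    positivity)
  have hK : 0 < energyConst m := by
    have : (0 : ℝ) < m := by exact_mod_cast hm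
    rw [energyConst]
    positivity
  refine ⟨κ * (√(energyConst m) * κ), by positivity, fun τ hτ f F ⟨hf, hF, hweak⟩ => ?_⟩
  obtain ⟨D, hDm, hDw, hD⟩ := exists_derivative_chain hτ m hweak
    fun b hb => intervalIntegrable_of_memLp hF hb
  refine ⟨fun j => D j, fun j => ⟨(hD j j.2).1, hDw j j.2.le⟩, fun a ha => ?_⟩
  have hv : MemLp (fun t => U (f t)) 2 (volume.restrict (openI τ)) := U.comp_memLp' hf
  have hD0 : (fun t => (B ^ (2 * m)) (U (f t))) =ᵐ[volume.restrict (openI τ)] D 0 := by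
    simp only [hUι]
    exact ae_eq_of_isWeakDeriv_zero (hDw 0 (Nat.zero_le m))
  -- The preimage of `D i 0` under the power of `B`: `c` compensates `fracPow = c • B ^ _`. The
  -- value `0` for `i ≥ m` is never used.
  set y : ℕ → H := fun i => if h : i < m then c ⟨i, h⟩ • (a ⟨i, h⟩).1.snd else 0 with hydef
  have hyFin : ∀ i : Fin m, y i = c i • (a i).1.snd := fun i => by simp [hydef]
  have hsmul : ∀ (j : Fin m) (x : H), fracPow (formInv ι) (traceExp m j / 2) x =
      (B ^ (2 * m - 2 * (j : ℕ) - 1)) (c j • x) := fun j x => by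
    rw [hc, smul_apply, ← ofReal_smul_eq (𝕜 := 𝕜), ← ofReal_smul_eq (𝕜 := 𝕜), map_smul]
  have hy : ∀ i < m, D i 0 = (B ^ (2 * m - 2 * i - 1)) (y i) := fun i hi => by
    have h1 : interpToH (a ⟨i, hi⟩) = D i 0 := ha ⟨i, hi⟩
    have h2 : (a ⟨i, hi⟩).1.fst =
        fracPow (formInv ι) (traceExp m i / 2) (a ⟨i, hi⟩).1.snd := (a ⟨i, hi⟩).2
    rw [← h1, hyFin ⟨i, hi⟩, ← hsmul ⟨i, hi⟩]
    exact h2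
  choose w hwc hw using fun j : Fin m =>
    exists_continuous_preimage hB hQc hQ1 hQlim hv hF hD0 hDm hD hy j.2
  set W : ℝ := (∫ t in openI τ, ‖U (f t)‖ ^ 2) + (∫ t in openI τ, ‖F t‖ ^ 2) +
    ∑ i ∈ Finset.range m, ‖y i‖ ^ 2 with hW
  have ha2 : ∀ i : Fin m, ‖(a i).1.snd‖ ≤ ‖a i‖ := fun i => by
    have := WithLp.prod_norm_sq_eq_of_L2 (a i).1
    refine le_of_sq_le_sq ?_ (norm_nonneg _)
    rw [Submodule.coe_norm, this]
    exact le_add_of_nonneg_left (sq_nonneg _)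
  have hZ0 : 0 ≤ normZ τ f F := Real.sqrt_nonneg _
  have hS0 : 0 ≤ ∑ i : Fin m, ‖a i‖ := Finset.sum_nonneg fun i _ => norm_nonneg _
  have hWle : W ≤ (κ * (normZ τ f F + ∑ i : Fin m, ‖a i‖)) ^ 2 := by
    have h1 : ∫ t in openI τ, ‖U (f t)‖ ^ 2 ≤ ∫ t in openI τ, ‖f t‖ ^ 2 :=
      integral_mono ((memLp_two_iff_integrable_sq_norm hv.1).1 hv)
        ((memLp_two_iff_integrable_sq_norm hf.1).1 hf)
        fun t => pow_le_pow_left₀ (norm_nonneg _) (hU _) 2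
    have h2 : (∫ t in openI τ, ‖f t‖ ^ 2) + ∫ t in openI τ, ‖F t‖ ^ 2 = normZ τ f F ^ 2 :=
      (Real.sq_sqrt (add_nonneg (integral_nonneg fun t => by positivity)
        (integral_nonneg fun t => by positivity))).symm
    have h3 : ∑ i ∈ Finset.range m, ‖y i‖ ^ 2 ≤ (κ * ∑ i : Fin m, ‖a i‖) ^ 2 := by
      rw [← Fin.sum_univ_eq_sum_range (fun i => ‖y i‖ ^ 2) m]
      refine (Finset.sum_sq_le_sq_sum_of_nonneg fun i _ => norm_nonneg _).trans ?_
      refine pow_le_pow_left₀ (Finset.sum_nonneg fun i _ => norm_nonneg _) ?_ 2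
      rw [Finset.mul_sum]
      refine Finset.sum_le_sum fun i _ => ?_
      rw [hyFin, norm_smul, Real.norm_of_nonneg (hc0 i).le]
      refine mul_le_mul ?_ (ha2 i) (norm_nonneg _) (by linarith)
      have := hterm i
      have h4 : 0 ≤ (c i)⁻¹ := (inv_pos.2 (hc0 i)).le
      linarith [norm_nonneg (B ^ (2 * m - 2 * (i : ℕ) - 1))]
    have h5 : normZ τ f F ^ 2 ≤ (κ * normZ τ f F) ^ 2 :=
      pow_le_pow_left₀ hZ0 (le_mul_of_one_le_left hZ0 hκ1) 2
    nlinarith [mul_nonneg (mul_nonneg (zero_le_one.trans hκ1) hZ0)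
      (mul_nonneg (zero_le_one.trans hκ1) hS0)]
  have hwle : ∀ (j : Fin m), ∀ t ∈ closedI τ,
      ‖w j t‖ ≤ √(energyConst m) * (κ * (normZ τ f F + ∑ i : Fin m, ‖a i‖)) := by
    intro j t ht
    refine le_of_sq_le_sq ?_ (by positivity)
    rw [mul_pow, Real.sq_sqrt hK.le]
    exact (hw j t ht).2.trans (mul_le_mul_of_nonneg_left hWle hK.le)
  -- The second component stands for `Λ^θ D_j`; dividing by `c j` makes `fracPow` return `B ^ _ (w j
  -- t) = D j t`.
  refine ⟨fun j t => ⟨WithLp.toLp 2 (fracPow (formInv ι) (traceExp m j / 2) ((c j)⁻¹ • w j t),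
    (c j)⁻¹ • w j t), rfl⟩, fun j t ht => ?_, fun j => ?_, fun j t ht => ?_⟩
  · have h1 := hsmul j ((c j)⁻¹ • w j t)
    rw [smul_inv_smul₀ (hc0 j).ne', (hw j t ht).1] at h1
    exact h1
  · have h1 : ContinuousOn (fun t => (c j)⁻¹ • w j t) (closedI τ) := (hwc j).const_smul _
    have h2 := (fracPow (formInv ι) (traceExp m j / 2)).continuous.comp_continuousOn h1
    refine Topology.IsInducing.subtypeVal.continuousOn_iff.2 ?_
    exact (WithLp.prod_continuous_toLp 2 H H).comp_continuousOn (h2.prodMk h1)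
  · have h1 := hsmul j ((c j)⁻¹ • w j t)
    rw [smul_inv_smul₀ (hc0 j).ne'] at h1
    rw [Submodule.coe_norm]
    simp only [h1]
    set p : WithLp 2 (H × H) :=
      WithLp.toLp 2 ((B ^ (2 * m - 2 * (j : ℕ) - 1)) (w j t), (c j)⁻¹ • w j t) with hp
    have h2 : ‖p‖ ≤ ‖p.fst‖ + ‖p.snd‖ := by
      refine le_of_sq_le_sq ?_ (by positivity)
      rw [WithLp.prod_norm_sq_eq_of_L2]
      nlinarith [mul_nonneg (norm_nonneg p.fst) (norm_nonneg p.snd)]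
    have h3 : ‖p.fst‖ ≤ ‖B ^ (2 * m - 2 * (j : ℕ) - 1)‖ * ‖w j t‖ :=
      ContinuousLinearMap.le_opNorm _ _
    have h4 : ‖p.snd‖ = (c j)⁻¹ * ‖w j t‖ := by
      change ‖(c j)⁻¹ • w j t‖ = _
      rw [norm_smul, Real.norm_of_nonneg (inv_pos.2 (hc0 j)).le]
    have h5 : ‖p‖ ≤ κ * ‖w j t‖ := by
      have := mul_le_mul_of_nonneg_right (hterm j) (norm_nonneg (w j t))
      have h6 := mul_nonneg (hc0 j).le (norm_nonneg (w j t))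
      linarith
    calc ‖p‖ ≤ κ * ‖w j t‖ := h5
      _ ≤ κ * (√(energyConst m) * (κ * (normZ τ f F + ∑ i : Fin m, ‖a i‖))) := by
        gcongr
        exact hwle j t ht
      _ = _ := by ring
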